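/- For $\ell\in\mathbb N=\{0,1,2,\dots\}$ and $d=2^\ell$, let $H=H_d\in\{\pm1\}^{d\times d}$ be the Hadamard matrix defined recursively by $H_1=[1]$ and $H_{2d}=\begin{bmatrix}H_d&H_d\\H_d&-H_d\end{bmatrix}$. For $m\in\mathbb N$ let $D^1,\dots,D^m\in\mathbb R^{d\times d}$ be random diagonal matrices whose $md$ diagonal entries $(D^j)_{k,k}$ are independent $\mathcal N(0,1)$ random variables, and for $z\in\mathbb R^d$ put $\tilde h_{j,k}(z)=(HD^jz)_k$ for $1\le j\le m$, $1\le k\le d$. Here $\|\cdot\|$ is the Euclidean norm, $\log$ is the natural logarithm, and $\mathcal N(0,\sigma^2)$ is the Gaussian distribution with mean $0$ and variance $\sigma^2$ (the point mass at $0$ if $\sigma=0$). **Theorem.** There is an absolute constant $C>0$ such that the following holds. Let $\ell\in\mathbb N$, $d=2^\ell$, $\delta,\varepsilon\in(0,1/2)$, let $f:\mathbb R\to\mathbb R$ be $1$-Lipschitz, and let $m\in\mathbb N$ satisfy $$m\ \ge\ C\,\varepsilon^{-2}\,\bigl(\log(d/\varepsilon)\bigr)^5\,\log(1/\delta).$$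 Then with probability at least $1-\delta$, $$\forall z\in\mathbb R^d \text{ with } \|z\|\le 1:\quad \left|\frac1{md}\sum_{j=1}^m\sum_{k=1}^d f\bigl(\tilde h_{j,k}(z)\bigr)-\mathbb E_{Z\sim\mathcal N(0,\|z\|^2)}[f(Z)]\right|\le\varepsilon .$$ -/

import Mathlib

open MeasureTheory ProbabilityTheory

/-- The Hadamard matrix of order `2 ^ ℓ` given by the recursion `H₁ = [1]`,
`H_{2d} = [[H_d, H_d], [H_d, -H_d]]`. -/
def hadamardMatrix : (ℓ : ℕ) → Matrix (Fin (2 ^ ℓ)) (Fin (2 ^ ℓ)) ℝ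
  | 0 => 1
  | ℓ + 1 =>
    let e : Fin (2 ^ ℓ) ⊕ Fin (2 ^ ℓ) ≃ Fin (2 ^ (ℓ + 1)) :=
      finSumFinEquiv.trans (finCongr (by rw [pow_succ, mul_two]))
    Matrix.reindex e e
      (Matrix.fromBlocks (hadamardMatrix ℓ) (hadamardMatrix ℓ)
        (hadamardMatrix ℓ) (-hadamardMatrix ℓ))

/-- The `k`-th coordinate of the `j`-th block of the stacked transform: `(H D^j z)_k`, where `D^j`
is the diagonal matrix with diagonal entries `g j 1, …, g j d`, and `d = 2 ^ ℓ`. -/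
def stackedRHT {ℓ m : ℕ} (g : Fin m → Fin (2 ^ ℓ) → ℝ) (z : EuclideanSpace ℝ (Fin (2 ^ ℓ)))
    (j : Fin m) (k : Fin (2 ^ ℓ)) : ℝ :=
  Matrix.mulVec (hadamardMatrix ℓ * Matrix.diagonal (g j)) z.ofLp k

/-! ### Gaussian concentration by rotation -/

section Concentration

/-! The coordinates within one block are dependent, but the rows of H are orthogonal. Hence the
derivative of the average (with f mollified), seen as a linear form in the Gaussian entries, has
variance at most B²/m when all entries of the vector are at most B (`variance_average_rhtForm_le`).
Flat vectors therefore concentrate far better than spiky ones.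

A union bound over a net of the whole ball is too expensive, so entries are treated by dyadic size.
Round z to a/2^r with a integral and strip the entries of a from the smallest upwards. At scale q at
most 4^(r-q) entries are left, and those stripped next are below 2^(q+1)/2^r. The number of
candidate vectors and the tail bound then carry the same exponent 4^(r-q), and the union bound
closes at every scale.

Stripped entries involve Gaussians independent of the remaining ones. Conditionally on the rest,
stripping them replaces f by its convolution with a Gaussian of the stripped variance, up to an
error t (`block_concentration`). Convolutions compose, so after r + 1 steps the vector is 0 and f
has become its Gaussian mean at variance ‖a/2^r‖² (`abs_rhtAverage_dyadicVector_sub_le`). With r of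
order log(d/ε), the choice t = ε/(2(r+1)) spends half of ε. The other half pays for rounding, which
is controlled by the averages of |·| at the basis vectors. -/

theorem ofReal_exp_integral_le_lintegral {α : Type*} [MeasurableSpace α] (ν : Measure α)
    [IsProbabilityMeasure ν] {u : α → ℝ} (hu : Integrable u ν) :
    ENNReal.ofReal (Real.exp (∫ x, u x ∂ν)) ≤ ∫⁻ x, ENNReal.ofReal (Real.exp (u x)) ∂ν := by
  have hm : AEStronglyMeasurable (fun x => Real.exp (u x)) ν :=
    Real.continuous_exp.comp_aestronglyMeasurable hu.1
  by_cases h : ∫⁻ x, ENNReal.ofReal (Real.exp (u x)) ∂ν = ⊤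
  · rw [h]; exact le_top
  · have hi : Integrable (fun x => Real.exp (u x)) ν :=
      (lintegral_ofReal_ne_top_iff_integrable hm (ae_of_all _ fun x => (Real.exp_pos _).le)).1 h
    rw [← ofReal_integral_eq_lintegral_ofReal hi (ae_of_all _ fun x => (Real.exp_pos _).le)]
    exact ENNReal.ofReal_le_ofReal
      (convexOn_exp.map_integral_le Real.continuous_exp.continuousOn isClosed_univ
        (ae_of_all _ fun _ => Set.mem_univ _) hu hi)

variable {E : Type*} [NormedAddCommGroup E] [NormedSpace ℝ E]

theorem hasDerivAt_comp_rotation {F : E → ℝ} {F' : E → StrongDual ℝ E}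
    (hF : ∀ x, HasFDerivAt F (F' x) x) (x y : E) (t : ℝ) :
    HasDerivAt (fun t => F (Real.cos (Real.pi / 2 * t) • x + Real.sin (Real.pi / 2 * t) • y))
      (Real.pi / 2 * F' (Real.cos (Real.pi / 2 * t) • x + Real.sin (Real.pi / 2 * t) • y)
        (-Real.sin (Real.pi / 2 * t) • x + Real.cos (Real.pi / 2 * t) • y)) t := by
  have hl : HasDerivAt (fun t : ℝ => Real.pi / 2 * t) (Real.pi / 2) t := by
    simpa using (hasDerivAt_id t).const_mul (Real.pi / 2)
  have h1 := ((hl.cos).smul_const x).add ((hl.sin).smul_const y)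
  have h2 := (hF (Real.cos (Real.pi / 2 * t) • x + Real.sin (Real.pi / 2 * t) • y)).comp_hasDerivAt
    t h1
  refine h2.congr_deriv ?_
  simp only [map_add, map_smul, smul_eq_mul]
  ring

variable [MeasurableSpace E] [BorelSpace E]

theorem lintegral_exp_strongDual_eq (μ : Measure E) [IsGaussian μ]
    (hμ : ∀ L : StrongDual ℝ E, μ[L] = 0) (L : StrongDual ℝ E) :
    ∫⁻ y, ENNReal.ofReal (Real.exp (L y)) ∂μ = ENNReal.ofReal (Real.exp (Var[L; μ] / 2)) := by
  have hmap := IsGaussian.map_eq_gaussianReal (μ := μ) L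
  rw [hμ L] at hmap
  have h1 : ∫⁻ y, ENNReal.ofReal (Real.exp (L y)) ∂μ
      = ∫⁻ x, ENNReal.ofReal (Real.exp x) ∂(μ.map L) := by
    rw [lintegral_map (by fun_prop) (by fun_prop)]
  rw [h1, hmap]
  have h2 := integrable_exp_mul_gaussianReal (μ := 0) (v := (Var[L; μ]).toNNReal) 1
  have h3 := congrFun (mgf_fun_id_gaussianReal (μ := 0) (v := (Var[L; μ]).toNNReal)) 1
  simp only [one_mul] at h2
  rw [← ofReal_integral_eq_lintegral_ofReal h2 (ae_of_all _ fun x => (Real.exp_pos _).le)]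
  simp only [mgf, one_mul] at h3
  rw [h3]
  simp [Real.coe_toNNReal _ (variance_nonneg _ _)]

variable [SecondCountableTopology E] [CompleteSpace E]

/-- Maurey–Pisier: F(y) - F(x) is the integral over a quarter turn of F' at one rotated coordinate
applied to the other. Jensen moves the exponential inside the integral, and rotation invariance of μ
× μ makes every angle contribute equally. For fixed x what remains is the Laplace transform of the
Gaussian F'(x)(y). Lower integrals avoid any prior exponential integrability. -/
theorem lintegral_exp_sub_le (μ : Measure E) [IsGaussian μ]
    (hμ : ∀ L : StrongDual ℝ E, μ[L] = 0) {F : E → ℝ} {F' : E → StrongDual ℝ E}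
    (hF : ∀ x, HasFDerivAt F (F' x) x) (hF' : Continuous F') {V : ℝ}
    (hV : ∀ x, Var[F' x; μ] ≤ V) (s : ℝ) :
    ∫⁻ p : E × E, ENNReal.ofReal (Real.exp (s * (F p.2 - F p.1))) ∂(μ.prod μ)
      ≤ ENNReal.ofReal (Real.exp ((s * (Real.pi / 2)) ^ 2 * V / 2)) := by
  set G : E × E → ℝ := fun q => s * (Real.pi / 2) * F' q.1 q.2 with hG
  have hGc : Continuous G := by
    refine continuous_const.mul ?_
    exact (hF'.comp continuous_fst).clm_apply continuous_snd
  set R : ℝ → E × E → E × E :=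
    fun t q => ContinuousLinearMap.rotation (Real.pi / 2 * t) q with hR
  have hRc : Continuous (fun q : ℝ × (E × E) => R q.1 q.2) := by
    simp only [hR, ContinuousLinearMap.rotation_apply]
    fun_prop
  have hcont : ∀ q, Continuous (fun t => G (R t q)) := fun q => by
    have h := hRc.comp (Continuous.prodMk continuous_id (continuous_const (y := q)))
    exact hGc.comp h
  clear_value G R
  set ν : Measure ℝ := volume.restrict (Set.Ioc 0 1) with hν
  have : IsProbabilityMeasure ν := ⟨by simp [hν]⟩
  have hint : ∀ q, ∫ t, G (R t q) ∂ν = s * (F q.2 - F q.1) := by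
    intro q
    have hd : ∀ t : ℝ, HasDerivAt (fun t => s * F ((R t q).1)) (G (R t q)) t := by
      intro t
      have := (hasDerivAt_comp_rotation hF q.1 q.2 t).const_mul s
      rw [← mul_assoc] at this
      simpa only [hG, hR, ContinuousLinearMap.rotation_apply, mul_assoc] using this
    have := intervalIntegral.integral_eq_sub_of_hasDerivAt (a := 0) (b := 1)
      (fun t _ => hd t) ((hcont q).intervalIntegrable _ _)
    rw [intervalIntegral.integral_of_le zero_le_one] at this
    rw [hν, this]
    simp [hR, ContinuousLinearMap.rotation_apply]
    ring
  have hinteg : ∀ q, Integrable (fun t => G (R t q)) ν := by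
    intro q
    exact ((hcont q).integrableOn_Icc (a := 0) (b := 1)).mono_set Set.Ioc_subset_Icc_self
  calc ∫⁻ p : E × E, ENNReal.ofReal (Real.exp (s * (F p.2 - F p.1))) ∂(μ.prod μ)
      ≤ ∫⁻ p : E × E, ∫⁻ t, ENNReal.ofReal (Real.exp (G (R t p))) ∂ν ∂(μ.prod μ) := by
        refine lintegral_mono fun p => ?_
        rw [← hint p]
        exact ofReal_exp_integral_le_lintegral ν (hinteg p)
    _ = ∫⁻ t, ∫⁻ p : E × E, ENNReal.ofReal (Real.exp (G (R t p))) ∂(μ.prod μ) ∂ν := by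
        refine lintegral_lintegral_swap ?_
        have : Continuous (fun q : (E × E) × ℝ => Real.exp (G (R q.2 q.1))) :=
          Real.continuous_exp.comp (hGc.comp (hRc.comp (continuous_snd.prodMk continuous_fst)))
        exact this.measurable.ennreal_ofReal.aemeasurable
    _ ≤ ∫⁻ t, ENNReal.ofReal (Real.exp ((s * (Real.pi / 2)) ^ 2 * V / 2)) ∂ν := by
        refine lintegral_mono fun t => ?_
        have hGm : Measurable (fun q => ENNReal.ofReal (Real.exp (G q))) :=
          (Real.continuous_exp.comp hGc).measurable.ennreal_ofReal
        have h1 : ∫⁻ p : E × E, ENNReal.ofReal (Real.exp (G (R t p))) ∂(μ.prod μ)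
            = ∫⁻ q, ENNReal.ofReal (Real.exp (G q)) ∂(μ.prod μ) := by
          conv_rhs => rw [← IsGaussian.map_rotation_eq_self_of_forall_strongDual_eq_zero hμ
            (Real.pi / 2 * t)]
          rw [lintegral_map hGm (by fun_prop), hR]
        rw [h1, lintegral_prod _ hGm.aemeasurable]
        calc ∫⁻ x, ∫⁻ y, ENNReal.ofReal (Real.exp (G (x, y))) ∂μ ∂μ
            ≤ ∫⁻ x, ENNReal.ofReal (Real.exp ((s * (Real.pi / 2)) ^ 2 * V / 2)) ∂μ := by
              refine lintegral_mono fun x => ?_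
              have h2 := lintegral_exp_strongDual_eq μ hμ ((s * (Real.pi / 2)) • F' x)
              simp only [smul_apply, smul_eq_mul] at h2
              simp only [hG]
              rw [h2]
              refine ENNReal.ofReal_le_ofReal (Real.exp_le_exp.2 ?_)
              have h3 : Var[((s * (Real.pi / 2)) • F' x : StrongDual ℝ E); μ]
                  = (s * (Real.pi / 2)) ^ 2 * Var[F' x; μ] := by
                rw [← variance_const_mul]
                rfl
              rw [h3]
              have := mul_le_mul_of_nonneg_left (hV x) (sq_nonneg (s * (Real.pi / 2)))
              linarith
          _ = _ := by simp
    _ = _ := by simp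

/-- Jensen replaces the mean by an independent copy. -/
theorem lintegral_exp_sub_integral_le (μ : Measure E) [IsGaussian μ]
    (hμ : ∀ L : StrongDual ℝ E, μ[L] = 0) {F : E → ℝ} {F' : E → StrongDual ℝ E}
    (hF : ∀ x, HasFDerivAt F (F' x) x) (hF' : Continuous F') (hFi : Integrable F μ) {V : ℝ}
    (hV : ∀ x, Var[F' x; μ] ≤ V) (s : ℝ) :
    ∫⁻ x, ENNReal.ofReal (Real.exp (s * (F x - ∫ y, F y ∂μ))) ∂μ
      ≤ ENNReal.ofReal (Real.exp (2 * s ^ 2 * V)) := by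
  have hV0 : 0 ≤ V := (variance_nonneg _ _).trans (hV 0)
  have hFc : Continuous F := continuous_iff_continuousAt.2 fun x => (hF x).continuousAt
  calc ∫⁻ x, ENNReal.ofReal (Real.exp (s * (F x - ∫ y, F y ∂μ))) ∂μ
      ≤ ∫⁻ x, ∫⁻ y, ENNReal.ofReal (Real.exp (-s * (F y - F x))) ∂μ ∂μ := by
        refine lintegral_mono fun x => ?_
        have hi : Integrable (fun y => -s * (F y - F x)) μ :=
          (hFi.sub (integrable_const _)).const_mul _
        have h := ofReal_exp_integral_le_lintegral μ hi
        have h1 : ∫ y, -s * (F y - F x) ∂μ = s * (F x - ∫ y, F y ∂μ) := by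
          rw [integral_const_mul, integral_sub hFi (integrable_const _)]
          simp only [integral_const, probReal_univ, smul_eq_mul, one_mul]
          ring
        rwa [h1] at h
    _ = ∫⁻ p : E × E, ENNReal.ofReal (Real.exp (-s * (F p.2 - F p.1))) ∂(μ.prod μ) := by
        rw [lintegral_prod]
        have : Continuous (fun p : E × E => Real.exp (-s * (F p.2 - F p.1))) := by fun_prop
        exact this.measurable.ennreal_ofReal.aemeasurable
    _ ≤ _ := lintegral_exp_sub_le μ hμ hF hF' hV (-s)
    _ ≤ _ := by
        refine ENNReal.ofReal_le_ofReal (Real.exp_le_exp.2 ?_)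
        have hpi : Real.pi ^ 2 ≤ 16 := by nlinarith [Real.pi_le_four, Real.pi_pos]
        have : 0 ≤ s ^ 2 * V := by positivity
        nlinarith

theorem measure_le_sub_integral_le (μ : Measure E) [IsGaussian μ]
    (hμ : ∀ L : StrongDual ℝ E, μ[L] = 0) {F : E → ℝ} {F' : E → StrongDual ℝ E}
    (hF : ∀ x, HasFDerivAt F (F' x) x) (hF' : Continuous F') (hFi : Integrable F μ) {V : ℝ}
    (hV : ∀ x, Var[F' x; μ] ≤ V) (hV0 : 0 < V) {t : ℝ} (ht : 0 < t) :
    μ {x | t ≤ F x - ∫ y, F y ∂μ} ≤ ENNReal.ofReal (Real.exp (-t ^ 2 / (8 * V))) := by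
  have hFc : Continuous F := continuous_iff_continuousAt.2 fun x => (hF x).continuousAt
  -- Minimizer of 2s²V - st in the Chernoff bound.
  set s : ℝ := t / (4 * V) with hs
  have hs0 : 0 < s := by positivity
  have h1 := lintegral_exp_sub_integral_le μ hμ hF hF' hFi hV s
  have hm : AEMeasurable
      (fun x => ENNReal.ofReal (Real.exp (s * (F x - ∫ y, F y ∂μ)))) μ := by
    have : Continuous (fun x => Real.exp (s * (F x - ∫ y, F y ∂μ))) := by fun_prop
    exact this.measurable.ennreal_ofReal.aemeasurable
  have h2 := mul_meas_ge_le_lintegral₀ hm (ENNReal.ofReal (Real.exp (s * t)))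
  have h3 : μ {x | t ≤ F x - ∫ y, F y ∂μ} ≤ μ {x | ENNReal.ofReal (Real.exp (s * t))
      ≤ ENNReal.ofReal (Real.exp (s * (F x - ∫ y, F y ∂μ)))} := by
    refine measure_mono fun x hx => ?_
    exact ENNReal.ofReal_le_ofReal (Real.exp_le_exp.2 (mul_le_mul_of_nonneg_left hx hs0.le))
  have h4 : ENNReal.ofReal (Real.exp (s * t)) * μ {x | t ≤ F x - ∫ y, F y ∂μ}
      ≤ ENNReal.ofReal (Real.exp (2 * s ^ 2 * V)) :=
    (mul_le_mul_right h3 _).trans (h2.trans h1)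
  have h5 : μ {x | t ≤ F x - ∫ y, F y ∂μ} = ENNReal.ofReal (Real.exp (-(s * t))) *
      (ENNReal.ofReal (Real.exp (s * t)) * μ {x | t ≤ F x - ∫ y, F y ∂μ}) := by
    rw [← mul_assoc, ← ENNReal.ofReal_mul (Real.exp_pos _).le, ← Real.exp_add]
    simp
  rw [h5]
  refine (mul_le_mul_right h4 _).trans ?_
  rw [← ENNReal.ofReal_mul (Real.exp_pos _).le, ← Real.exp_add]
  refine ENNReal.ofReal_le_ofReal (Real.exp_le_exp.2 (le_of_eq ?_))
  rw [hs]; field_simp; ring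

theorem measure_le_abs_sub_integral_le (μ : Measure E) [IsGaussian μ]
    (hμ : ∀ L : StrongDual ℝ E, μ[L] = 0) {F : E → ℝ} {F' : E → StrongDual ℝ E}
    (hF : ∀ x, HasFDerivAt F (F' x) x) (hF' : Continuous F') (hFi : Integrable F μ) {V : ℝ}
    (hV : ∀ x, Var[F' x; μ] ≤ V) (hV0 : 0 < V) {t : ℝ} (ht : 0 < t) :
    μ {x | t ≤ |F x - ∫ y, F y ∂μ|} ≤ ENNReal.ofReal (2 * Real.exp (-t ^ 2 / (8 * V))) := by
  have h1 := measure_le_sub_integral_le μ hμ hF hF' hFi hV hV0 ht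
  have h2 := measure_le_sub_integral_le μ hμ (F := fun x => -F x) (F' := fun x => -F' x)
    (fun x => (hF x).neg) hF'.neg hFi.neg (V := V) (fun x => by
      have : Var[(-F' x : StrongDual ℝ E); μ] = Var[F' x; μ] := by
        exact variance_neg (X := F' x) (μ := μ)
      rw [this]; exact hV x) hV0 ht
  rw [two_mul, ENNReal.ofReal_add (Real.exp_pos _).le (Real.exp_pos _).le]
  refine le_trans ?_ (add_le_add h1 h2)
  refine le_trans (measure_mono ?_) (measure_union_le _ _)
  intro x hx
  simp only [Set.mem_ofPred_eq, Set.mem_union] at hx ⊢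
  rw [integral_neg]
  rcases le_abs.1 hx with h | h
  · left; exact h
  · right; linarith

end Concentration

/-! ### Mollification and concentration of Lipschitz averages -/

section Mollify

/-- The average of `f` over `[x, x + h]`. -/
noncomputable def steklovMean (f : ℝ → ℝ) (h x : ℝ) : ℝ :=
  h⁻¹ * ((∫ u in (0 : ℝ)..(x + h), f u) - ∫ u in (0 : ℝ)..x, f u)

theorem hasDerivAt_steklovMean {f : ℝ → ℝ} (hf : Continuous f) (h x : ℝ) :
    HasDerivAt (steklovMean f h) (h⁻¹ * (f (x + h) - f x)) x := by
  have h1 : ∀ y, HasDerivAt (fun y => ∫ u in (0 : ℝ)..y, f u) (f y) y := fun y =>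
    intervalIntegral.integral_hasDerivAt_right (hf.intervalIntegrable _ _)
      (hf.stronglyMeasurableAtFilter _ _) hf.continuousAt
  have h2 := (h1 (x + h)).comp_add_const x h
  exact (h2.sub (h1 x)).const_mul h⁻¹

theorem abs_steklovMean_sub_le {f : ℝ → ℝ} (hf : LipschitzWith 1 f) {h : ℝ} (hh : 0 < h) (x : ℝ) :
    |steklovMean f h x - f x| ≤ h := by
  have hc := hf.continuous
  have h1 : steklovMean f h x - f x = h⁻¹ * ∫ u in x..(x + h), (f u - f x) := by
    rw [steklovMean, intervalIntegral.integral_interval_sub_left (hc.intervalIntegrable _ _)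
      (hc.intervalIntegrable _ _), intervalIntegral.integral_sub (hc.intervalIntegrable _ _)
      (by simp), intervalIntegral.integral_const]
    simp only [smul_eq_mul]
    field_simp
    ring
  have h2 : ‖∫ u in x..(x + h), (f u - f x)‖ ≤ h * |x + h - x| := by
    refine intervalIntegral.norm_integral_le_of_norm_le_const fun u hu => ?_
    rw [Set.uIoc_of_le (by linarith)] at hu
    have := hf.dist_le_mul u x
    rw [Real.dist_eq, Real.dist_eq] at this
    rw [Real.norm_eq_abs]
    simp only [NNReal.coe_one, one_mul] at this
    refine this.trans ?_
    rw [abs_of_nonneg] <;> linarith [hu.1, hu.2]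
  rw [h1, abs_mul, abs_of_pos (inv_pos.2 hh)]
  rw [Real.norm_eq_abs] at h2
  calc h⁻¹ * |∫ u in x..(x + h), (f u - f x)| ≤ h⁻¹ * (h * |x + h - x|) := by gcongr
    _ = h := by
      rw [add_sub_cancel_left, abs_of_pos hh]; field_simp

theorem LipschitzWith.abs_sub_le {f : ℝ → ℝ} (hf : LipschitzWith 1 f) (x y : ℝ) :
    |f x - f y| ≤ |x - y| := by
  have := hf.dist_le_mul x y
  simpa [Real.dist_eq] using this

theorem LipschitzWith.integrable_comp {α : Type*} [MeasurableSpace α] {μ : Measure α}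
    [IsFiniteMeasure μ] {f : ℝ → ℝ} (hf : LipschitzWith 1 f) {X : α → ℝ} (hX : Integrable X μ) :
    Integrable (fun a => f (X a)) μ := by
  have h1 : Integrable (fun a => |X a| + |f 0|) μ := hX.abs.add (integrable_const _)
  refine h1.mono' (hf.continuous.comp_aestronglyMeasurable hX.1) (ae_of_all _ fun a => ?_)
  have := hf.abs_sub_le (X a) 0
  rw [sub_zero] at this
  have h2 := abs_sub_abs_le_abs_sub (f (X a)) (f 0)
  rw [Real.norm_eq_abs]; linarith

end Mollify

/-- The derivative of a Steklov mean is a difference quotient of f, hence continuous and bounded by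
1. The differential of the mollified average is thus one of the combinations that `hvar` controls,
and `hc1` lets uniform errors pass to the average. -/
theorem gaussian_average_concentration {E : Type*} [NormedAddCommGroup E] [NormedSpace ℝ E]
    [MeasurableSpace E] [BorelSpace E] [SecondCountableTopology E] [CompleteSpace E]
    (μ : Measure E) [IsGaussian μ] (hμ : ∀ L : StrongDual ℝ E, μ[L] = 0)
    {ι : Type*} [Fintype ι] (L : ι → StrongDual ℝ E) (a : ι → ℝ) {f : ℝ → ℝ}
    (hf : LipschitzWith 1 f) {c V t : ℝ} (hc : 0 ≤ c) (hc1 : c * Fintype.card ι ≤ 1) (hV : 0 < V)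
    (hvar : ∀ u : ι → ℝ, (∀ i, |u i| ≤ 1) → Var[(c • ∑ i, u i • L i : StrongDual ℝ E); μ] ≤ V)
    (ht : 0 < t) :
    μ {x | t ≤ |c * ∑ i, f (a i + L i x) - c * ∑ i, ∫ y, f (a i + L i y) ∂μ|}
      ≤ ENNReal.ofReal (2 * Real.exp (-t ^ 2 / (32 * V))) := by
  -- Mollifying both the average and its mean costs 2h = t/2, which leaves t/2 for concentration.
  set h : ℝ := t / 4 with hh
  have hh0 : 0 < h := by positivity
  set fh := steklovMean f h with hfh
  have hfc := hf.continuous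
  have hfd : ∀ x, HasDerivAt fh (h⁻¹ * (f (x + h) - f x)) x := hasDerivAt_steklovMean hfc h
  have hdiff : ∀ x, |fh x - f x| ≤ h := abs_steklovMean_sub_le hf hh0
  clear_value fh
  have hfhc : Continuous fh := continuous_iff_continuousAt.2 fun x => (hfd x).continuousAt
  have hLi : ∀ i, Integrable (fun y => a i + L i y) μ := fun i =>
    (integrable_const _).add ((L i).integrable_comp IsGaussian.integrable_id)
  have hfi : ∀ i, Integrable (fun y => f (a i + L i y)) μ := fun i => hf.integrable_comp (hLi i)
  have hfhi : ∀ i, Integrable (fun y => fh (a i + L i y)) μ := fun i => by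
    have h1 : Integrable (fun y => fh (a i + L i y) - f (a i + L i y)) μ := by
      refine (integrable_const h).mono' ?_ (ae_of_all _ fun y => hdiff _)
      have : Continuous (fun y => fh (a i + L i y) - f (a i + L i y)) := by fun_prop
      exact this.aestronglyMeasurable
    refine (h1.add (hfi i)).congr (ae_of_all _ fun y => ?_)
    simp
  set F : E → ℝ := fun x => c * ∑ i, fh (a i + L i x) with hF
  set F' : E → StrongDual ℝ E :=
    fun x => c • ∑ i, (h⁻¹ * (f (a i + L i x + h) - f (a i + L i x))) • L i with hF'
  have hFd : ∀ x, HasFDerivAt F (F' x) x := by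
    intro x
    have h1 : ∀ i, HasFDerivAt (fun x => fh (a i + L i x))
        ((h⁻¹ * (f (a i + L i x + h) - f (a i + L i x))) • L i) x := fun i =>
      (hfd (a i + L i x)).comp_hasFDerivAt x (((L i).hasFDerivAt).const_add (a i))
    exact (HasFDerivAt.fun_sum fun i _ => h1 i).const_mul c
  have hF'c : Continuous F' := by
    simp only [hF']; fun_prop
  have hFi : Integrable F μ := (integrable_finsetSum _ fun i _ => hfhi i).const_mul c
  have hFV : ∀ x, Var[F' x; μ] ≤ V := fun x => hvar _ fun i => by
    rw [abs_mul, abs_of_pos (inv_pos.2 hh0)]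
    have := hf.abs_sub_le (a i + L i x + h) (a i + L i x)
    rw [add_sub_cancel_left, abs_of_pos hh0] at this
    calc h⁻¹ * |f (a i + L i x + h) - f (a i + L i x)| ≤ h⁻¹ * h := by gcongr
      _ = 1 := by field_simp
  have hFint : ∫ y, F y ∂μ = c * ∑ i, ∫ y, fh (a i + L i y) ∂μ := by
    simp only [hF]
    rw [integral_const_mul, integral_finsetSum _ fun i _ => hfhi i]
  have key := measure_le_abs_sub_integral_le μ hμ hFd hF'c hFi hFV hV (t := t / 2) (by positivity)
  have hcomp : ∀ A B : ι → ℝ, (∀ i, |A i - B i| ≤ h) → |c * ∑ i, A i - c * ∑ i, B i| ≤ h := by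
    intro A B hAB
    rw [← mul_sub, ← Finset.sum_sub_distrib, abs_mul, abs_of_nonneg hc]
    calc c * |∑ i, (A i - B i)| ≤ c * ∑ i : ι, h := by
          gcongr
          exact (Finset.abs_sum_le_sum_abs _ _).trans (Finset.sum_le_sum fun i _ => hAB i)
      _ = (c * Fintype.card ι) * h := by simp [mul_assoc]
      _ ≤ 1 * h := by gcongr
      _ = h := one_mul h
  refine (measure_mono ?_).trans (key.trans (le_of_eq ?_))
  · intro x hx
    simp only [Set.mem_ofPred_eq] at hx ⊢
    have h1 := hcomp (fun i => fh (a i + L i x)) (fun i => f (a i + L i x)) fun i => hdiff _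
    have h2 := hcomp (fun i => ∫ y, fh (a i + L i y) ∂μ) (fun i => ∫ y, f (a i + L i y) ∂μ)
      fun i => by
        rw [← integral_sub (hfhi i) (hfi i)]
        have := norm_integral_le_of_norm_le_const (μ := μ) (C := h)
          (f := fun y => fh (a i + L i y) - f (a i + L i y)) (ae_of_all _ fun y => hdiff _)
        simpa using this
    rw [hFint]
    simp only [hF]
    have e1 := abs_le.1 h1
    have e2 := abs_le.1 h2
    rcases le_abs.1 hx with h3 | h3
    · refine le_abs.2 (Or.inl ?_); linarith
    · refine le_abs.2 (Or.inr ?_); linarith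
  · congr 3
    field_simp
    ring

/-! ### Orthogonality of the Hadamard matrix -/

section Hadamard

theorem hadamardMatrix_mul_transpose (ℓ : ℕ) :
    hadamardMatrix ℓ * (hadamardMatrix ℓ).transpose = ((2 : ℝ) ^ ℓ) • 1 := by
  induction ℓ with
  | zero => simp [hadamardMatrix]
  | succ ℓ ih =>
    simp only [hadamardMatrix, Matrix.reindex_apply,
      Matrix.submatrix_mul_equiv, Matrix.fromBlocks_transpose, Matrix.fromBlocks_multiply,
      Matrix.transpose_neg, Matrix.transpose_submatrix, Matrix.mul_neg, Matrix.neg_mul, neg_neg, ih, add_neg_cancel]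
    rw [← two_smul ℝ (((2 : ℝ) ^ ℓ) • (1 : Matrix (Fin (2 ^ ℓ)) (Fin (2 ^ ℓ)) ℝ)), smul_smul,
      ← pow_succ']
    have hb : Matrix.fromBlocks ((2 : ℝ) ^ (ℓ + 1) • (1 : Matrix (Fin (2 ^ ℓ)) (Fin (2 ^ ℓ)) ℝ)) 0 0
        ((2 : ℝ) ^ (ℓ + 1) • (1 : Matrix (Fin (2 ^ ℓ)) (Fin (2 ^ ℓ)) ℝ))
        = (2 : ℝ) ^ (ℓ + 1) • 1 := by
      rw [← Matrix.fromBlocks_one, Matrix.fromBlocks_smul, smul_zero]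
    rw [hb, Matrix.submatrix_smul, Pi.smul_apply, Pi.smul_apply, Matrix.submatrix_one_equiv]

theorem hadamardMatrix_sq (ℓ : ℕ) (i j : Fin (2 ^ ℓ)) : hadamardMatrix ℓ i j ^ 2 = 1 := by
  induction ℓ with
  | zero =>
    have : i = j := Subsingleton.elim (α := Fin 1) i j
    subst this
    change (1 : Matrix (Fin (2 ^ 0)) (Fin (2 ^ 0)) ℝ) i i ^ 2 = 1
    rw [Matrix.one_apply_eq, one_pow]
  | succ ℓ ih =>
    simp only [hadamardMatrix, Matrix.reindex_apply, Matrix.submatrix_apply]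
    generalize (Equiv.symm _) i = a
    generalize (Equiv.symm _) j = b
    rcases a with a | a <;> rcases b with b | b <;> simp [ih]

theorem sum_sq_vecMul_hadamardMatrix (ℓ : ℕ) (c : Fin (2 ^ ℓ) → ℝ) :
    ∑ k', (∑ k, c k * hadamardMatrix ℓ k k') ^ 2 = (2 : ℝ) ^ ℓ * ∑ k, c k ^ 2 := by
  have h1 : ∑ k', (∑ k, c k * hadamardMatrix ℓ k k') ^ 2
      = dotProduct (Matrix.vecMul c (hadamardMatrix ℓ)) (Matrix.vecMul c (hadamardMatrix ℓ)) := by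
    simp [dotProduct, Matrix.vecMul, sq]
  have h2 : Matrix.vecMul c (hadamardMatrix ℓ) = Matrix.mulVec (hadamardMatrix ℓ).transpose c := by
    rw [Matrix.mulVec_transpose]
  rw [h1]
  nth_rewrite 2 [h2]
  rw [Matrix.dotProduct_mulVec, Matrix.vecMul_vecMul, hadamardMatrix_mul_transpose,
    Matrix.vecMul_smul, Matrix.vecMul_one, smul_dotProduct, smul_eq_mul]
  simp [dotProduct, sq]

end Hadamard

/-! ### Linear forms under the standard Gaussian -/

section StandardGaussian

/-- The standard Gaussian measure on `ι → ℝ`. -/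
noncomputable abbrev gaussianPi (ι : Type*) [Fintype ι] : Measure (ι → ℝ) :=
  Measure.pi fun _ => gaussianReal 0 1

variable {ι : Type*} [Fintype ι]

theorem iIndepFun_eval_gaussianPi :
    iIndepFun (fun (i : ι) (x : ι → ℝ) => x i) (gaussianPi ι) :=
  iIndepFun_pi (μ := fun _ : ι => gaussianReal 0 1) (X := fun _ x => x) fun _ => aemeasurable_id

instance isGaussian_gaussianPi : IsGaussian (gaussianPi ι) := by
  have h : HasGaussianLaw (fun (x : ι → ℝ) i => x i) (gaussianPi ι) := by
    refine iIndepFun.hasGaussianLaw (fun i => ?_) iIndepFun_eval_gaussianPi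
    refine ⟨?_⟩
    rw [(measurePreserving_eval (fun _ : ι => gaussianReal 0 1) i).map_eq]
    infer_instance
  have := h.isGaussian_map
  simpa using this

theorem strongDual_pi_apply [DecidableEq ι] (L : StrongDual ℝ (ι → ℝ)) (x : ι → ℝ) :
    L x = ∑ i, L (Pi.single i 1) * x i := by
  conv_lhs => rw [← Finset.univ_sum_single x]
  rw [map_sum]
  refine Finset.sum_congr rfl fun i _ => ?_
  rw [mul_comm, ← smul_eq_mul, ← map_smul, ← Pi.single_smul, smul_eq_mul, mul_one]

theorem integral_strongDual_gaussianPi (L : StrongDual ℝ (ι → ℝ)) : (gaussianPi ι)[L] = 0 := by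
  classical
  rw [integral_congr_ae (ae_of_all _ (strongDual_pi_apply L))]
  rw [integral_finsetSum]
  · refine Finset.sum_eq_zero fun i _ => ?_
    rw [integral_const_mul, integral_eval]
    simp
  · intro i _
    exact (integrable_eval (μ := fun _ : ι => gaussianReal 0 1) (i := i)
      IsGaussian.integrable_id).const_mul _

theorem variance_strongDual_gaussianPi [DecidableEq ι] (L : StrongDual ℝ (ι → ℝ)) :
    Var[L; gaussianPi ι] = ∑ i, L (Pi.single i 1) ^ 2 := by
  have h : (L : (ι → ℝ) → ℝ) = ∑ i, fun x : ι → ℝ => L (Pi.single i 1) * x i := by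
    ext x
    rw [strongDual_pi_apply, Finset.sum_apply]
  conv_lhs => rw [h]
  rw [variance_sum_pi (μ := fun _ : ι => gaussianReal 0 1)
    (X := fun i x => L (Pi.single i 1) * x)]
  · refine Finset.sum_congr rfl fun i _ => ?_
    rw [variance_const_mul, variance_fun_id_gaussianReal]
    simp
  · exact fun i => IsGaussian.memLp_two_id.const_mul _

end StandardGaussian

/-! ### Gaussian convolution -/

section Smoothing

/-- The convolution of `f` with the centred Gaussian of variance `v`. -/
noncomputable def gaussianSmooth (f : ℝ → ℝ) (v : NNReal) (x : ℝ) : ℝ :=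
  ∫ s, f (x + s) ∂gaussianReal 0 v

theorem integrable_add_gaussianReal {f : ℝ → ℝ} (hf : LipschitzWith 1 f) (v : NNReal) (x : ℝ) :
    Integrable (fun s => f (x + s)) (gaussianReal 0 v) :=
  hf.integrable_comp ((integrable_const x).add IsGaussian.integrable_fun_id)

theorem lipschitzWith_gaussianSmooth {f : ℝ → ℝ} (hf : LipschitzWith 1 f) (v : NNReal) :
    LipschitzWith 1 (gaussianSmooth f v) := by
  refine LipschitzWith.of_dist_le_mul fun x y => ?_
  rw [Real.dist_eq, Real.dist_eq, gaussianSmooth, gaussianSmooth,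
    ← integral_sub (integrable_add_gaussianReal hf v x) (integrable_add_gaussianReal hf v y)]
  have := norm_integral_le_of_norm_le_const (μ := gaussianReal 0 v) (C := |x - y|)
    (f := fun s => f (x + s) - f (y + s)) (ae_of_all _ fun s => by
      have := hf.abs_sub_le (x + s) (y + s)
      rwa [add_sub_add_right_eq_sub] at this)
  simpa using this

theorem gaussianSmooth_gaussianSmooth {f : ℝ → ℝ} (hf : LipschitzWith 1 f) (v w : NNReal) :
    gaussianSmooth (gaussianSmooth f v) w = gaussianSmooth f (v + w) := by
  ext x
  have h := gaussianReal_conv_gaussianReal (m₁ := 0) (m₂ := 0) (v₁ := w) (v₂ := v)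
  rw [add_zero] at h
  simp only [gaussianSmooth]
  rw [add_comm v w, ← h, integral_conv]
  · simp_rw [add_assoc]
  · rw [h]; exact integrable_add_gaussianReal hf _ x

@[simp]
theorem gaussianSmooth_zero (f : ℝ → ℝ) : gaussianSmooth f 0 = f := by
  ext x; simp [gaussianSmooth]

end Smoothing

/-! ### The stacked transform as Gaussian linear forms -/

section Transform

variable {ℓ m : ℕ}

/-- The coordinate `i` of the stacked transform of `x`, as a linear form in the Gaussian entries. -/
noncomputable def rhtForm (x : Fin (2 ^ ℓ) → ℝ) (i : Fin m × Fin (2 ^ ℓ)) :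
    StrongDual ℝ (Fin m × Fin (2 ^ ℓ) → ℝ) :=
  ∑ k, (hadamardMatrix ℓ i.2 k * x k) • ContinuousLinearMap.proj (i.1, k)

theorem rhtForm_apply (x : Fin (2 ^ ℓ) → ℝ) (i : Fin m × Fin (2 ^ ℓ))
    (g : Fin m × Fin (2 ^ ℓ) → ℝ) :
    rhtForm x i g = ∑ k, hadamardMatrix ℓ i.2 k * x k * g (i.1, k) := by
  simp [rhtForm]

theorem rhtForm_single (x : Fin (2 ^ ℓ) → ℝ) (i p : Fin m × Fin (2 ^ ℓ)) :
    rhtForm x i (Pi.single p 1) = if i.1 = p.1 then hadamardMatrix ℓ i.2 p.2 * x p.2 else 0 := by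
  rw [rhtForm_apply]
  rcases p with ⟨j, k⟩
  simp only [Pi.single_apply, Prod.mk.injEq]
  split_ifs with h
  · simp [h]
  · simp [h]

theorem rhtForm_add_apply (x y : Fin (2 ^ ℓ) → ℝ) (i : Fin m × Fin (2 ^ ℓ))
    (g : Fin m × Fin (2 ^ ℓ) → ℝ) :
    rhtForm (x + y) i g = rhtForm x i g + rhtForm y i g := by
  simp only [rhtForm_apply, ← Finset.sum_add_distrib, Pi.add_apply]
  exact Finset.sum_congr rfl fun k _ => by ring

theorem variance_rhtForm (x : Fin (2 ^ ℓ) → ℝ) (i : Fin m × Fin (2 ^ ℓ)) :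
    Var[rhtForm x i; gaussianPi (Fin m × Fin (2 ^ ℓ))] = ∑ k, x k ^ 2 := by
  rw [variance_strongDual_gaussianPi, Fintype.sum_prod_type]
  simp [rhtForm_single, ite_pow, mul_pow, hadamardMatrix_sq]

/-- Once the entries of x are bounded by B, Parseval for H in each block gives at most (md)⁻² · B² ·
m · d². It is the sup norm of x, not the Euclidean one, that enters. -/
theorem variance_average_rhtForm_le (hm : 0 < m) {x : Fin (2 ^ ℓ) → ℝ} {B : ℝ}
    (hB : ∀ k, |x k| ≤ B) {u : Fin m × Fin (2 ^ ℓ) → ℝ} (hu : ∀ i, |u i| ≤ 1) :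
    Var[((1 / ((m : ℝ) * 2 ^ ℓ)) • ∑ i, u i • rhtForm x i :
      StrongDual ℝ (Fin m × Fin (2 ^ ℓ) → ℝ)); gaussianPi (Fin m × Fin (2 ^ ℓ))] ≤ B ^ 2 / m := by
  rw [variance_strongDual_gaussianPi]
  have hm' : (0 : ℝ) < m := by exact_mod_cast hm
  have h1 : ∀ p : Fin m × Fin (2 ^ ℓ),
      ((1 / ((m : ℝ) * 2 ^ ℓ)) • ∑ i, u i • rhtForm x i :
        StrongDual ℝ (Fin m × Fin (2 ^ ℓ) → ℝ)) (Pi.single p 1)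
      = 1 / ((m : ℝ) * 2 ^ ℓ) * (x p.2 * ∑ k, u (p.1, k) * hadamardMatrix ℓ k p.2) := by
    intro p
    simp only [smul_apply, sum_apply, smul_eq_mul, rhtForm_single, Fintype.sum_prod_type]
    congr 1
    rw [Finset.sum_eq_single p.1]
    · simp only [if_true, Finset.mul_sum]
      exact Finset.sum_congr rfl fun k _ => by ring
    · intro j _ hj; simp [hj]
    · simp
  simp_rw [h1]
  calc ∑ p : Fin m × Fin (2 ^ ℓ),
        (1 / ((m : ℝ) * 2 ^ ℓ) * (x p.2 * ∑ k, u (p.1, k) * hadamardMatrix ℓ k p.2)) ^ 2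
      ≤ ∑ p : Fin m × Fin (2 ^ ℓ), (1 / ((m : ℝ) * 2 ^ ℓ)) ^ 2 * (B ^ 2 *
          (∑ k, u (p.1, k) * hadamardMatrix ℓ k p.2) ^ 2) := by
        refine Finset.sum_le_sum fun p _ => ?_
        rw [mul_pow, mul_pow]
        have : x p.2 ^ 2 ≤ B ^ 2 := sq_le_sq' (neg_le_of_abs_le (hB _)) (le_of_abs_le (hB _))
        gcongr
    _ = (1 / ((m : ℝ) * 2 ^ ℓ)) ^ 2 * (B ^ 2 * ∑ j, 2 ^ ℓ * ∑ k, u (j, k) ^ 2) := by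
        rw [← Finset.mul_sum, ← Finset.mul_sum, Fintype.sum_prod_type]
        simp only [sum_sq_vecMul_hadamardMatrix]
    _ ≤ (1 / ((m : ℝ) * 2 ^ ℓ)) ^ 2 * (B ^ 2 * ∑ j : Fin m, 2 ^ ℓ * ∑ k : Fin (2 ^ ℓ), 1) := by
        gcongr with j _ k _
        rw [← sq_abs]
        exact pow_le_one₀ (abs_nonneg _) (hu _)
    _ = B ^ 2 / m := by
        simp
        field_simp

theorem integral_rhtForm (f : ℝ → ℝ) (hf : Continuous f) (x : Fin (2 ^ ℓ) → ℝ)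
    (i : Fin m × Fin (2 ^ ℓ)) (a : ℝ) :
    ∫ g, f (a + rhtForm x i g) ∂gaussianPi (Fin m × Fin (2 ^ ℓ))
      = gaussianSmooth f (∑ k, x k ^ 2).toNNReal a := by
  have hmap := IsGaussian.map_eq_gaussianReal
    (μ := gaussianPi (Fin m × Fin (2 ^ ℓ))) (rhtForm x i)
  rw [integral_strongDual_gaussianPi, variance_rhtForm] at hmap
  rw [gaussianSmooth, ← hmap, integral_map (by fun_prop)]
  exact (hf.comp (by fun_prop)).aestronglyMeasurable

/-- Disjoint supports make the two families read disjoint sets of Gaussian entries. -/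
theorem indepFun_rhtForm {x w : Fin (2 ^ ℓ) → ℝ} (hxw : ∀ k, x k = 0 ∨ w k = 0) :
    IndepFun (fun g (i : Fin m × Fin (2 ^ ℓ)) => rhtForm x i g)
      (fun g (i : Fin m × Fin (2 ^ ℓ)) => rhtForm w i g) (gaussianPi (Fin m × Fin (2 ^ ℓ))) := by
  classical
  set S : Finset (Fin m × Fin (2 ^ ℓ)) := Finset.univ.filter fun p => x p.2 ≠ 0 with hS
  set T : Finset (Fin m × Fin (2 ^ ℓ)) := Finset.univ.filter fun p => x p.2 = 0 with hT
  have hST : Disjoint S T := by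
    rw [Finset.disjoint_left]; intro p hp hq
    simp only [hS, hT, Finset.mem_filter] at hp hq
    exact hp.2 hq.2
  have h := (iIndepFun_eval_gaussianPi (ι := Fin m × Fin (2 ^ ℓ))).indepFun_finset S T hST
    fun i => measurable_pi_apply i
  let φ (y : Fin (2 ^ ℓ) → ℝ) (U : Finset (Fin m × Fin (2 ^ ℓ))) (r : U → ℝ)
    (i : Fin m × Fin (2 ^ ℓ)) : ℝ :=
    ∑ k, hadamardMatrix ℓ i.2 k * y k * (if hk : (i.1, k) ∈ U then r ⟨(i.1, k), hk⟩ else 0)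
  have hφ : ∀ y U, Measurable (φ y U) := by
    intro y U
    refine measurable_pi_lambda _ fun i => Finset.measurable_sum _ fun k _ => ?_
    refine Measurable.const_mul ?_ _
    split_ifs
    · exact measurable_pi_apply _
    · exact measurable_const
  have h2 := h.comp (hφ x S) (hφ w T)
  convert h2 using 1
  · ext g i
    simp only [rhtForm_apply, Function.comp, φ]
    refine Finset.sum_congr rfl fun k _ => ?_
    by_cases hk : x k = 0
    · simp [hk]
    · simp [hS, hk]
  · ext g i
    simp only [rhtForm_apply, Function.comp, φ]
    refine Finset.sum_congr rfl fun k _ => ?_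
    by_cases hk : x k = 0
    · simp [hT, hk]
    · simp [(hxw k).resolve_left hk]

/-- Freezing the forms of x leaves an average of f(a_i + L_i) in the forms of w alone, whose means
are Gaussian convolutions of f at a_i. The bound is uniform in a, so Fubini integrates it. -/
theorem block_concentration (hm : 0 < m) {f : ℝ → ℝ} (hf : LipschitzWith 1 f)
    {x w : Fin (2 ^ ℓ) → ℝ} (hxw : ∀ k, x k = 0 ∨ w k = 0) {B : ℝ} (hB0 : 0 < B)
    (hB : ∀ k, |w k| ≤ B) {t : ℝ} (ht : 0 < t) :
    gaussianPi (Fin m × Fin (2 ^ ℓ)) {g | t ≤ |1 / ((m : ℝ) * 2 ^ ℓ) * ∑ i, f (rhtForm (x + w) i g)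
        - 1 / ((m : ℝ) * 2 ^ ℓ) * ∑ i, gaussianSmooth f (∑ k, w k ^ 2).toNNReal (rhtForm x i g)|}
      ≤ ENNReal.ofReal (2 * Real.exp (-(m * t ^ 2) / (32 * B ^ 2))) := by
  have hm' : (0 : ℝ) < m := by exact_mod_cast hm
  set c : ℝ := 1 / ((m : ℝ) * 2 ^ ℓ) with hc
  set γ := gaussianPi (Fin m × Fin (2 ^ ℓ)) with hγ
  set v := (∑ k, w k ^ 2).toNNReal with hv
  set X : (Fin m × Fin (2 ^ ℓ) → ℝ) → Fin m × Fin (2 ^ ℓ) → ℝ := fun g i => rhtForm x i g with hX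
  set W : (Fin m × Fin (2 ^ ℓ) → ℝ) → Fin m × Fin (2 ^ ℓ) → ℝ := fun g i => rhtForm w i g with hW
  have hXm : Measurable X := by simp only [hX]; fun_prop
  have hWm : Measurable W := by simp only [hW]; fun_prop
  have hind : IndepFun X W γ := indepFun_rhtForm hxw
  have hlaw := (indepFun_iff_map_prod_eq_prod_map_map hXm.aemeasurable hWm.aemeasurable).1 hind
  have hfc := hf.continuous
  have hsc := (lipschitzWith_gaussianSmooth hf v).continuous
  set A : Set ((Fin m × Fin (2 ^ ℓ) → ℝ) × (Fin m × Fin (2 ^ ℓ) → ℝ)) :=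
    {p | t ≤ |c * ∑ i, f (p.1 i + p.2 i) - c * ∑ i, gaussianSmooth f v (p.1 i)|} with hA
  have hAm : MeasurableSet A := by
    refine (isClosed_le continuous_const ?_).measurableSet
    fun_prop
  have h1 : {g | t ≤ |c * ∑ i, f (rhtForm (x + w) i g)
      - c * ∑ i, gaussianSmooth f v (rhtForm x i g)|} = (fun g => (X g, W g)) ⁻¹' A := by
    ext g
    simp only [hA, hX, hW, Set.mem_preimage, Set.mem_ofPred_eq, rhtForm_add_apply]
  rw [h1, ← Measure.map_apply (hXm.prodMk hWm) hAm, hlaw, Measure.prod_apply hAm]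
  have : IsProbabilityMeasure (γ.map X) := Measure.isProbabilityMeasure_map hXm.aemeasurable
  calc ∫⁻ a, (γ.map W) (Prod.mk a ⁻¹' A) ∂(γ.map X)
      ≤ ∫⁻ a, ENNReal.ofReal (2 * Real.exp (-(m * t ^ 2) / (32 * B ^ 2))) ∂(γ.map X) := by
        refine lintegral_mono fun a => ?_
        rw [Measure.map_apply hWm (measurable_prodMk_left hAm)]
        have h2 := gaussian_average_concentration γ integral_strongDual_gaussianPi
          (fun i => rhtForm w i) a hf (c := c) (V := B ^ 2 / m) (t := t) (by positivity)
          (le_of_eq (by simp [hc]; field_simp)) (by positivity)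
          (fun u hu => variance_average_rhtForm_le hm hB hu) ht
        have h3 : ∀ i, ∫ g, f (a i + rhtForm w i g) ∂γ = gaussianSmooth f v (a i) := fun i =>
          integral_rhtForm f hfc w i (a i)
        simp only [h3] at h2
        refine h2.trans (le_of_eq ?_)
        congr 3
        field_simp
    _ = _ := by simp

end Transform

/-! ### Integer rounding and sparse vectors -/

section Rounding

/-- Rounding is towards zero, so that the rounded vector stays in the unit ball. -/
theorem exists_int_abs_le_abs_abs_sub_le_one (y : ℝ) : ∃ n : ℤ, |(n : ℝ)| ≤ |y| ∧ |y - n| ≤ 1 := by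
  rcases le_total 0 y with h | h
  · refine ⟨⌊y⌋, ?_, ?_⟩
    · rw [abs_of_nonneg h, abs_of_nonneg (by exact_mod_cast Int.floor_nonneg.2 h)]
      exact Int.floor_le y
    · rw [abs_le]; constructor <;> linarith [Int.floor_le y, Int.lt_floor_add_one y]
  · refine ⟨⌈y⌉, ?_, ?_⟩
    · rw [abs_of_nonpos h, abs_of_nonpos (by exact_mod_cast Int.ceil_le.2 (by simpa using h))]
      linarith [Int.le_ceil y]
    · rw [abs_le]; constructor <;> linarith [Int.le_ceil y, Int.ceil_lt_add_one y]

variable {K : Type*}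

/-- The entries of `a` of absolute value at least `T`. -/
def hardThreshold (T : ℤ) (a : K → ℤ) (k : K) : ℤ := if T ≤ |a k| then a k else 0

/-- The vector with the entries of `a` divided by `2 ^ r`. -/
noncomputable def dyadicVector (r : ℕ) (a : K → ℤ) (k : K) : ℝ := a k / 2 ^ r

open Classical in
/-- A vector with entry `(p i).2` at position `(p i).1` for every `i`, and zeros elsewhere. -/
noncomputable def sparseVector {s : ℕ} (p : Fin s → K × ℤ) (k : K) : ℤ :=
  if h : ∃ i, (p i).1 = k then (p h.choose).2 else 0

theorem exists_subset_range_of_card_le [Nonempty K] (S : Finset K) {s : ℕ} (h : S.card ≤ s) :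
    ∃ e : Fin s → K, ∀ k ∈ S, ∃ i, e i = k := by
  rcases S.eq_empty_or_nonempty with rfl | hS
  · exact ⟨fun _ => Classical.arbitrary K, by simp⟩
  · have : Nonempty S := hS.to_subtype
    obtain ⟨φ⟩ : Nonempty (S ↪ Fin s) := Function.Embedding.nonempty_of_card_le (by simpa using h)
    refine ⟨fun i => (Function.invFun φ i : S), fun k hk => ⟨φ ⟨k, hk⟩, ?_⟩⟩
    simp only [Function.leftInverse_invFun φ.injective _]

/-- Lists of (position, value) pairs parametrize sparse vectors redundantly, but their number is a
plain s-th power. Repeated positions are harmless because they carry the same value. -/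
theorem exists_sparseVector_eq [Nonempty K] {a : K → ℤ} (S : Finset K) {s : ℕ} (h : S.card ≤ s)
    (hS : ∀ k, k ∉ S → a k = 0) {R : ℤ} (hR : ∀ k, |a k| ≤ R) :
    ∃ p : Fin s → K × Finset.Icc (-R) R, sparseVector (fun i => ((p i).1, ((p i).2 : ℤ))) = a := by
  obtain ⟨e, he⟩ := exists_subset_range_of_card_le S h
  refine ⟨fun i => (e i, ⟨a (e i), Finset.mem_Icc.2 (abs_le.1 (hR _))⟩), ?_⟩
  ext k
  simp only [sparseVector]
  split_ifs with hk
  · rw [hk.choose_spec]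
  · exact (hS k fun hkS => hk (he k hkS)).symm

variable [Fintype K]

theorem card_le_abs_le {a : K → ℤ} {r q : ℕ} (hq : q ≤ r) (ha : ∑ k, a k ^ 2 ≤ 4 ^ r) :
    (Finset.univ.filter fun k => (2 : ℤ) ^ q ≤ |a k|).card ≤ 4 ^ (r - q) := by
  set S := Finset.univ.filter fun k => (2 : ℤ) ^ q ≤ |a k| with hS
  have h1 : (S.card : ℤ) * 4 ^ q ≤ 4 ^ r := by
    calc (S.card : ℤ) * 4 ^ q = ∑ k ∈ S, 4 ^ q := by simp
      _ ≤ ∑ k ∈ S, a k ^ 2 := by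
        refine Finset.sum_le_sum fun k hk => ?_
        have h2 : (2 : ℤ) ^ q ≤ |a k| := (Finset.mem_filter.1 hk).2
        rw [← sq_abs, show (4 : ℤ) = 2 ^ 2 by norm_num, ← pow_mul, mul_comm, pow_mul]
        exact pow_le_pow_left₀ (by positivity) h2 2
      _ ≤ ∑ k, a k ^ 2 :=
        Finset.sum_le_sum_of_subset_of_nonneg (Finset.subset_univ _) fun _ _ _ => sq_nonneg _
      _ ≤ 4 ^ r := ha
  have h3 : S.card * 4 ^ q ≤ 4 ^ (r - q) * 4 ^ q := by
    rw [← pow_add, Nat.sub_add_cancel hq]; exact_mod_cast h1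
  exact Nat.le_of_mul_le_mul_right h3 (by positivity)

end Rounding

/-! ### Gaussian means as a function of the variance -/

section GaussianMean

theorem integral_abs_gaussianReal_le : ∫ s, |s| ∂gaussianReal 0 1 ≤ 1 := by
  have hi : Integrable (fun s : ℝ => s ^ 2) (gaussianReal 0 1) :=
    (IsGaussian.memLp_two_id (μ := gaussianReal 0 1)).integrable_sq
  have h2 : ∫ s, s ^ 2 ∂gaussianReal 0 1 = 1 := by
    have := variance_fun_id_gaussianReal (μ := 0) (v := 1)
    rw [variance_eq_integral measurable_id'.aemeasurable] at this
    simpa using this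
  calc ∫ s, |s| ∂gaussianReal 0 1 ≤ ∫ s, (1 + s ^ 2) / 2 ∂gaussianReal 0 1 := by
        refine integral_mono (IsGaussian.integrable_fun_id.abs)
          (((integrable_const 1).add hi).div_const 2) fun s => ?_
        simp only
        rw [← sq_abs s]; nlinarith [sq_nonneg (|s| - 1)]
    _ = 1 := by
        rw [integral_div, integral_add (integrable_const _) hi, h2]; simp

theorem gaussianSmooth_apply_zero {f : ℝ → ℝ} (hf : Continuous f) (v : NNReal) :
    gaussianSmooth f v 0 = ∫ s, f (Real.sqrt v * s) ∂gaussianReal 0 1 := by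
  have h := gaussianReal_map_const_mul (μ := 0) (v := 1) (Real.sqrt v)
  have hv : (NNReal.mk (Real.sqrt v ^ 2) (sq_nonneg _)) * 1 = v := by
    ext; simp
  rw [mul_zero, hv] at h
  rw [gaussianSmooth, ← h, integral_map (by fun_prop)]
  · simp
  · exact (hf.comp (by fun_prop)).aestronglyMeasurable

theorem abs_gaussianSmooth_sub_le {f : ℝ → ℝ} (hf : LipschitzWith 1 f) (v w : NNReal) :
    |gaussianSmooth f v 0 - gaussianSmooth f w 0| ≤ |Real.sqrt v - Real.sqrt w| := by
  have hi : ∀ v : NNReal, Integrable (fun s => f (Real.sqrt v * s)) (gaussianReal 0 1) := fun v =>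
    hf.integrable_comp (IsGaussian.integrable_fun_id.const_mul _)
  rw [gaussianSmooth_apply_zero hf.continuous, gaussianSmooth_apply_zero hf.continuous,
    ← integral_sub (hi v) (hi w)]
  calc |∫ s, (f (Real.sqrt v * s) - f (Real.sqrt w * s)) ∂gaussianReal 0 1|
      ≤ ∫ s, |f (Real.sqrt v * s) - f (Real.sqrt w * s)| ∂gaussianReal 0 1 :=
        abs_integral_le_integral_abs
    _ ≤ ∫ s, |Real.sqrt v - Real.sqrt w| * |s| ∂gaussianReal 0 1 := by
        refine integral_mono ((hi v).sub (hi w)).abs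
          (IsGaussian.integrable_fun_id.abs.const_mul _) fun s => ?_
        simp only
        rw [← abs_mul, sub_mul]
        exact hf.abs_sub_le _ _
    _ = |Real.sqrt v - Real.sqrt w| * ∫ s, |s| ∂gaussianReal 0 1 := integral_const_mul _ _
    _ ≤ |Real.sqrt v - Real.sqrt w| * 1 := by gcongr; exact integral_abs_gaussianReal_le
    _ = _ := mul_one _

end GaussianMean

/-! ### Empirical averages and the multiscale telescope -/

section Average

variable {ℓ m : ℕ}

/-- The empirical average of `f` over the coordinates of the stacked transform of `x`. -/
noncomputable def rhtAverage (g : Fin m × Fin (2 ^ ℓ) → ℝ) (f : ℝ → ℝ) (x : Fin (2 ^ ℓ) → ℝ) : ℝ :=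
  1 / ((m : ℝ) * 2 ^ ℓ) * ∑ i, f (rhtForm x i g)

theorem rhtForm_eq_sum (g : Fin m × Fin (2 ^ ℓ) → ℝ) (x : Fin (2 ^ ℓ) → ℝ)
    (i : Fin m × Fin (2 ^ ℓ)) : rhtForm x i g = ∑ k, x k * rhtForm (Pi.single k 1) i g := by
  rw [rhtForm_apply]
  refine Finset.sum_congr rfl fun k _ => ?_
  rw [rhtForm_apply, Finset.sum_eq_single k]
  · rw [Pi.single_eq_same]; ring
  · intro k' _ hk; simp [hk]
  · simp

theorem rhtForm_zero (i : Fin m × Fin (2 ^ ℓ)) : rhtForm (0 : Fin (2 ^ ℓ) → ℝ) i = 0 := by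
  simp [rhtForm]

theorem rhtAverage_zero (hm : 0 < m) (g : Fin m × Fin (2 ^ ℓ) → ℝ) (f : ℝ → ℝ) :
    rhtAverage g f 0 = f 0 := by
  have hm' : (m : ℝ) ≠ 0 := by exact_mod_cast hm.ne'
  simp [rhtAverage, rhtForm_zero]
  field_simp

/-- The triangle inequality over basis vectors loses a factor d, which is affordable since the
rounding precision enters the final bound only logarithmically. -/
theorem rhtAverage_abs_le (g : Fin m × Fin (2 ^ ℓ) → ℝ) {η A : ℝ} (hη : 0 ≤ η)
    (hg : ∀ k, rhtAverage g (fun s => |s|) (Pi.single k 1) ≤ A) {u : Fin (2 ^ ℓ) → ℝ}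
    (hu : ∀ k, |u k| ≤ η) : rhtAverage g (fun s => |s|) u ≤ 2 ^ ℓ * η * A := by
  calc rhtAverage g (fun s => |s|) u
      ≤ 1 / ((m : ℝ) * 2 ^ ℓ) * ∑ i, ∑ k, η * |rhtForm (Pi.single k 1) i g| := by
        refine mul_le_mul_of_nonneg_left (Finset.sum_le_sum fun i _ => ?_) (by positivity)
        rw [rhtForm_eq_sum]
        refine (Finset.abs_sum_le_sum_abs _ _).trans (Finset.sum_le_sum fun k _ => ?_)
        rw [abs_mul]
        exact mul_le_mul_of_nonneg_right (hu k) (abs_nonneg _)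
    _ = ∑ k, η * rhtAverage g (fun s => |s|) (Pi.single k 1) := by
        rw [Finset.sum_comm, Finset.mul_sum]
        refine Finset.sum_congr rfl fun k _ => ?_
        rw [rhtAverage, ← Finset.mul_sum]; ring
    _ ≤ ∑ k : Fin (2 ^ ℓ), η * A :=
        Finset.sum_le_sum fun k _ => mul_le_mul_of_nonneg_left (hg k) hη
    _ = 2 ^ ℓ * η * A := by simp [mul_assoc]

theorem abs_rhtAverage_sub_le (g : Fin m × Fin (2 ^ ℓ) → ℝ) {f : ℝ → ℝ} (hf : LipschitzWith 1 f)
    (x y : Fin (2 ^ ℓ) → ℝ) :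
    |rhtAverage g f x - rhtAverage g f y| ≤ rhtAverage g (fun s => |s|) (x - y) := by
  rw [rhtAverage, rhtAverage, ← mul_sub, ← Finset.sum_sub_distrib, abs_mul,
    abs_of_nonneg (show (0 : ℝ) ≤ 1 / ((m : ℝ) * 2 ^ ℓ) by positivity)]
  refine mul_le_mul_of_nonneg_left ?_ (by positivity)
  refine (Finset.abs_sum_le_sum_abs _ _).trans (Finset.sum_le_sum fun i _ => ?_)
  have h := rhtForm_add_apply (x - y) y i g
  rw [sub_add_cancel] at h
  have h2 := hf.abs_sub_le (rhtForm x i g) (rhtForm y i g)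
  rwa [show rhtForm x i g - rhtForm y i g = rhtForm (x - y) i g by linarith] at h2

theorem gaussianPi_two_le_rhtAverage_abs_single_le (hm : 0 < m) (k : Fin (2 ^ ℓ)) :
    gaussianPi (Fin m × Fin (2 ^ ℓ)) {g | 2 ≤ rhtAverage g (fun s => |s|) (Pi.single k 1)}
      ≤ ENNReal.ofReal (2 * Real.exp (-(m : ℝ) / 32)) := by
  have hf : LipschitzWith 1 (fun s : ℝ => |s|) := by
    refine LipschitzWith.of_dist_le_mul fun x y => ?_
    simpa [Real.dist_eq] using abs_abs_sub_abs_le x y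
  have h := block_concentration hm hf (x := 0) (w := Pi.single k 1) (fun _ => Or.inl rfl)
    (B := 1) one_pos (fun k' => by
      by_cases hk : k' = k
      · subst hk; simp
      · simp [hk]) (t := 1) one_pos
  simp only [one_pow, mul_one] at h
  refine (measure_mono fun g hg => ?_).trans h
  have hsum : (∑ k', (Pi.single k 1 : Fin (2 ^ ℓ) → ℝ) k' ^ 2).toNNReal = 1 := by
    rw [Finset.sum_eq_single k]
    · simp
    · intro k' _ hk; simp [hk]
    · simp
  have h0 := rhtAverage_zero hm g (gaussianSmooth (fun s => |s|) 1)
  simp only [Set.mem_ofPred_eq, zero_add, hsum] at hg ⊢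
  change 1 ≤ |rhtAverage g (fun s => |s|) (Pi.single k 1)
    - rhtAverage g (gaussianSmooth (fun s => |s|) 1) 0|
  have h1 : gaussianSmooth (fun s => |s|) 1 0 ≤ 1 := by
    simpa [gaussianSmooth] using integral_abs_gaussianReal_le
  rw [h0]
  exact le_abs.2 (Or.inl (by linarith))

/-- The event that replacing the entries of `b` smaller than `2 ^ (q + 1)` by independent Gaussian
smoothing moves the average of `gaussianSmooth f (n / 4 ^ r)` by at least `t`. -/
def scaleDeviation (m : ℕ) (f : ℝ → ℝ) (t : ℝ) (r q : ℕ) (b : Fin (2 ^ ℓ) → ℤ) (n : ℕ) :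
    Set (Fin m × Fin (2 ^ ℓ) → ℝ) :=
  {g | t ≤ |rhtAverage g (gaussianSmooth f (n / 4 ^ r)) (dyadicVector r b)
    - rhtAverage g (gaussianSmooth f (n / 4 ^ r +
        (∑ k, dyadicVector r (b - hardThreshold (2 ^ (q + 1)) b) k ^ 2).toNNReal))
      (dyadicVector r (hardThreshold (2 ^ (q + 1)) b))|}

/-- This is `block_concentration` with B = 2^(q+1)/2^r. The tail is written as a 4^(r-q)-th power to
match the count of sparse vectors. -/
theorem gaussianPi_scaleDeviation_le (hm : 0 < m) {f : ℝ → ℝ} (hf : LipschitzWith 1 f) {t : ℝ}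
    (ht : 0 < t) {r q : ℕ} (hq : q ≤ r) (b : Fin (2 ^ ℓ) → ℤ) (n : ℕ) :
    gaussianPi (Fin m × Fin (2 ^ ℓ)) (scaleDeviation m f t r q b n)
      ≤ ENNReal.ofReal (2 * Real.exp (-(m * t ^ 2) / 128) ^ 4 ^ (r - q)) := by
  have h := block_concentration hm (lipschitzWith_gaussianSmooth hf (n / 4 ^ r))
    (x := dyadicVector r (hardThreshold (2 ^ (q + 1)) b))
    (w := dyadicVector r (b - hardThreshold (2 ^ (q + 1)) b))
    (fun k => by
      simp only [dyadicVector, hardThreshold, Pi.sub_apply]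
      split_ifs <;> simp)
    (B := 2 ^ (q + 1) / 2 ^ r) (by positivity)
    (fun k => by
      simp only [dyadicVector, hardThreshold, Pi.sub_apply]
      rw [abs_div, abs_of_pos (show (0 : ℝ) < 2 ^ r by positivity)]
      gcongr
      split_ifs with hk
      · simp
      · rw [sub_zero]
        exact_mod_cast (not_le.1 hk).le) ht
  have hadd : dyadicVector r (hardThreshold (2 ^ (q + 1)) b) +
      dyadicVector r (b - hardThreshold (2 ^ (q + 1)) b) = dyadicVector r b := by
    ext k
    simp only [dyadicVector, Pi.add_apply, Pi.sub_apply, Int.cast_sub]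
    ring
  rw [hadd, gaussianSmooth_gaussianSmooth hf] at h
  refine h.trans (le_of_eq ?_)
  congr 2
  rw [← Real.exp_nat_mul]
  congr 1
  obtain ⟨c, rfl⟩ := Nat.exists_eq_add_of_le hq
  rw [Nat.add_sub_cancel_left]
  have h4 : (4 : ℝ) ^ c = 2 ^ c * 2 ^ c := by rw [← mul_pow]; norm_num
  push_cast
  rw [h4, pow_succ, pow_add]
  field_simp
  ring

theorem abs_rhtAverage_dyadicVector_sub_le (hm : 0 < m) {f : ℝ → ℝ} {t : ℝ}
    {r : ℕ} {g : Fin m × Fin (2 ^ ℓ) → ℝ}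
    (hg : ∀ q ≤ r, ∀ (p : Fin (4 ^ (r - q)) → Fin (2 ^ ℓ) × Finset.Icc (-2 ^ r : ℤ) (2 ^ r))
      (n : ℕ), n ≤ 4 ^ r →
      g ∉ scaleDeviation m f t r q (sparseVector fun i => ((p i).1, ((p i).2 : ℤ))) n)
    {a : Fin (2 ^ ℓ) → ℤ} (ha : ∑ k, a k ^ 2 ≤ 4 ^ r) :
    |rhtAverage g f (dyadicVector r a)
      - gaussianSmooth f (∑ k, dyadicVector r a k ^ 2).toNNReal 0| ≤ (r + 1) * t := by
  have haR : ∀ k, |a k| ≤ 2 ^ r := fun k => by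
    have h1 : a k ^ 2 ≤ (2 ^ r) ^ 2 := by
      rw [← pow_mul, mul_comm, pow_mul]
      exact (Finset.single_le_sum (fun _ _ => sq_nonneg _) (Finset.mem_univ k)).trans ha
    exact abs_le_of_sq_le_sq h1 (by positivity)
  -- The squared mass stripped before scale q is an integer at most 4^r, so only finitely many
  -- smoothed versions of f occur.
  set N : ℕ → ℕ := fun q => (∑ k, (a k - hardThreshold (2 ^ q) a k) ^ 2).toNat with hN
  have hNc : ∀ q, (N q : ℤ) = ∑ k, (a k - hardThreshold (2 ^ q) a k) ^ 2 := fun q =>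
    Int.toNat_of_nonneg (Finset.sum_nonneg fun _ _ => sq_nonneg _)
  have hNle : ∀ q, N q ≤ 4 ^ r := fun q => by
    zify
    rw [hNc]
    refine (Finset.sum_le_sum fun k _ => ?_).trans ha
    rw [hardThreshold]; split_ifs
    · simpa using sq_nonneg (a k)
    · simp
  set A : ℕ → ℝ := fun q => rhtAverage g (gaussianSmooth f (N q / 4 ^ r))
    (dyadicVector r (hardThreshold (2 ^ q) a)) with hA
  have hA0 : A 0 = rhtAverage g f (dyadicVector r a) := by
    have h1 : hardThreshold 1 a = a := by
      ext k
      rw [hardThreshold]; split_ifs with h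
      · rfl
      · rw [not_le, Int.abs_lt_one_iff] at h
        exact h.symm
    have h2 : N 0 = 0 := by simp [hN, h1]
    simp [hA, h1, h2]
  have hAr : A (r + 1) = gaussianSmooth f (∑ k, dyadicVector r a k ^ 2).toNNReal 0 := by
    have h1 : hardThreshold (2 ^ (r + 1)) a = 0 := by
      ext k
      rw [hardThreshold, if_neg]
      · rfl
      · rw [not_le]
        exact (haR k).trans_lt (pow_lt_pow_right₀ (by norm_num) (Nat.lt_succ_self r))
    have h2 : dyadicVector r (0 : Fin (2 ^ ℓ) → ℤ) = 0 := by ext k; simp [dyadicVector]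
    have h3 : ((N (r + 1) : NNReal) / 4 ^ r) = (∑ k, dyadicVector r a k ^ 2).toNNReal := by
      ext
      rw [Real.coe_toNNReal _ (Finset.sum_nonneg fun _ _ => sq_nonneg _)]
      have := congrArg (Int.cast : ℤ → ℝ) (hNc (r + 1))
      simp only [h1, Pi.zero_apply, sub_zero] at this
      push_cast at this ⊢
      rw [this, Finset.sum_div]
      refine Finset.sum_congr rfl fun k _ => ?_
      rw [dyadicVector, div_pow, ← pow_mul, mul_comm r, pow_mul]; norm_num
    simp only [hA]
    rw [h1, h2, rhtAverage_zero hm, h3]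
  have hstep : ∀ q ∈ Finset.range (r + 1), |A q - A (q + 1)| ≤ t := by
    intro q hq
    have hq' : q ≤ r := Nat.lt_succ_iff.1 (Finset.mem_range.1 hq)
    obtain ⟨p, hp⟩ := exists_sparseVector_eq (a := hardThreshold (2 ^ q) a)
      (Finset.univ.filter fun k => (2 : ℤ) ^ q ≤ |a k|) (card_le_abs_le hq' ha)
      (fun k hk => by
        rw [hardThreshold, if_neg]
        simpa using hk)
      (R := 2 ^ r) (fun k => by
        rw [hardThreshold]; split_ifs
        · exact haR k
        · simp)
    have h := hg q hq' p (N q) (hNle q)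
    rw [hp, scaleDeviation, Set.mem_ofPred_eq, not_le] at h
    have h1 : hardThreshold (2 ^ (q + 1)) (hardThreshold (2 ^ q) a)
        = hardThreshold (2 ^ (q + 1)) a := by
      ext k
      have : (2 : ℤ) ^ q ≤ 2 ^ (q + 1) := pow_le_pow_right₀ (by norm_num) (Nat.le_succ q)
      simp only [hardThreshold]
      by_cases h1 : (2 : ℤ) ^ q ≤ |a k|
      · simp [h1]
      · have h2 : ¬ (2 : ℤ) ^ (q + 1) ≤ |a k| := fun h => h1 (this.trans h)
        simp [h1, h2]
    -- Each entry is stripped at a single scale, so the variances add.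
    have h2 : ((N q : NNReal) / 4 ^ r + (∑ k, dyadicVector r (hardThreshold (2 ^ q) a
        - hardThreshold (2 ^ (q + 1)) a) k ^ 2).toNNReal) = N (q + 1) / 4 ^ r := by
      ext
      push_cast
      rw [Real.coe_toNNReal _ (Finset.sum_nonneg fun _ _ => sq_nonneg _)]
      have e1 := congrArg (Int.cast : ℤ → ℝ) (hNc q)
      have e2 := congrArg (Int.cast : ℤ → ℝ) (hNc (q + 1))
      push_cast at e1 e2
      rw [e1, e2, Finset.sum_div, Finset.sum_div, ← Finset.sum_add_distrib]
      refine Finset.sum_congr rfl fun k _ => ?_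
      have : (2 : ℤ) ^ q ≤ 2 ^ (q + 1) := pow_le_pow_right₀ (by norm_num) (Nat.le_succ q)
      rw [dyadicVector, div_pow, ← pow_mul, mul_comm r, pow_mul]
      norm_num
      rw [← add_div]
      congr 1
      simp only [hardThreshold]
      by_cases h1 : (2 : ℤ) ^ q ≤ |a k|
      · simp [h1]
      · have h2 : ¬ (2 : ℤ) ^ (q + 1) ≤ |a k| := fun h => h1 (this.trans h)
        simp [h1, h2]
    rw [h1, h2] at h
    exact h.le
  rw [← hA0, ← hAr, ← Finset.sum_range_sub']
  refine (Finset.abs_sum_le_sum_abs _ _).trans ((Finset.sum_le_sum hstep).trans ?_)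
  simp

end Average

/-! ### Union bound and passage to all z -/

section UniformBound

variable {ℓ m : ℕ}

/-- Count times tail at scale q is X^(4^(r-q)), where X is the left side of `hX`. Since X ≤ 1, every
scale costs at most what the coarsest, q = r, costs. -/
theorem gaussianPi_iUnion_scaleDeviation_le (hm : 0 < m) {f : ℝ → ℝ} (hf : LipschitzWith 1 f)
    {t : ℝ} (ht : 0 < t) (r : ℕ)
    (hX : 2 ^ ℓ * (2 * 2 ^ r + 1) * Real.exp (-(m * t ^ 2) / 128) ≤ 1) :
    gaussianPi (Fin m × Fin (2 ^ ℓ)) (⋃ q ∈ Finset.range (r + 1),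
      ⋃ p : Fin (4 ^ (r - q)) → Fin (2 ^ ℓ) × Finset.Icc (-2 ^ r : ℤ) (2 ^ r),
      ⋃ n ∈ Finset.range (4 ^ r + 1),
        scaleDeviation m f t r q (sparseVector fun i => ((p i).1, ((p i).2 : ℤ))) n)
    ≤ ENNReal.ofReal ((r + 1) * ((4 ^ r + 1) *
        (2 * (2 ^ ℓ * (2 * 2 ^ r + 1) * Real.exp (-(m * t ^ 2) / 128))))) := by
  set y := Real.exp (-(m * t ^ 2) / 128) with hy
  have hy0 : 0 ≤ y := (Real.exp_pos _).le
  have hcard : Fintype.card (Finset.Icc (-2 ^ r : ℤ) (2 ^ r)) = 2 * 2 ^ r + 1 := by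
    rw [Fintype.card_coe, Int.card_Icc]
    have : (2 ^ r + 1 - -2 ^ r : ℤ) = ((2 * 2 ^ r + 1 : ℕ) : ℤ) := by push_cast; ring
    rw [this, Int.toNat_natCast]
  calc _ ≤ ∑ q ∈ Finset.range (r + 1),
      ∑ p : Fin (4 ^ (r - q)) → Fin (2 ^ ℓ) × Finset.Icc (-2 ^ r : ℤ) (2 ^ r),
      ∑ n ∈ Finset.range (4 ^ r + 1), ENNReal.ofReal (2 * y ^ 4 ^ (r - q)) := by
        refine (measure_biUnion_finset_le _ _).trans (Finset.sum_le_sum fun q hq => ?_)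
        refine (measure_iUnion_fintype_le _ _).trans (Finset.sum_le_sum fun p _ => ?_)
        refine (measure_biUnion_finset_le _ _).trans (Finset.sum_le_sum fun n _ => ?_)
        exact gaussianPi_scaleDeviation_le hm hf ht
          (Nat.lt_succ_iff.1 (Finset.mem_range.1 hq)) _ n
    _ = ∑ q ∈ Finset.range (r + 1), ENNReal.ofReal ((4 ^ r + 1) *
        (2 * (2 ^ ℓ * (2 * 2 ^ r + 1) * y) ^ 4 ^ (r - q))) := by
        refine Finset.sum_congr rfl fun q _ => ?_
        rw [Finset.sum_const, Finset.sum_const, Finset.card_univ, Fintype.card_fun,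
          Fintype.card_prod, hcard, Fintype.card_fin, Fintype.card_fin, Finset.card_range,
          nsmul_eq_mul, nsmul_eq_mul, ← ENNReal.ofReal_natCast, ← ENNReal.ofReal_natCast,
          ← ENNReal.ofReal_mul (by positivity), ← ENNReal.ofReal_mul (by positivity)]
        congr 1
        push_cast
        rw [mul_pow _ y]
        ring
    _ ≤ ∑ q ∈ Finset.range (r + 1), ENNReal.ofReal ((4 ^ r + 1) *
        (2 * (2 ^ ℓ * (2 * 2 ^ r + 1) * y))) := by
        refine Finset.sum_le_sum fun q _ => ENNReal.ofReal_le_ofReal ?_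
        have := pow_le_of_le_one (by positivity) hX (n := 4 ^ (r - q)) (by positivity)
        gcongr
    _ = _ := by
        rw [Finset.sum_const, Finset.card_range, nsmul_eq_mul, ← ENNReal.ofReal_natCast,
          ← ENNReal.ofReal_mul (by positivity)]
        push_cast
        rfl

theorem abs_rhtAverage_sub_integral_le (hm : 0 < m) {f : ℝ → ℝ} (hf : LipschitzWith 1 f)
    {t : ℝ} {r : ℕ} {g : Fin m × Fin (2 ^ ℓ) → ℝ}
    (hg : ∀ q ≤ r, ∀ (p : Fin (4 ^ (r - q)) → Fin (2 ^ ℓ) × Finset.Icc (-2 ^ r : ℤ) (2 ^ r))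
      (n : ℕ), n ≤ 4 ^ r →
      g ∉ scaleDeviation m f t r q (sparseVector fun i => ((p i).1, ((p i).2 : ℤ))) n)
    (hg2 : ∀ k, rhtAverage g (fun s => |s|) (Pi.single k 1) ≤ 2)
    (z : EuclideanSpace ℝ (Fin (2 ^ ℓ))) (hz : ‖z‖ ≤ 1) :
    |rhtAverage g f z.ofLp - ∫ x, f x ∂gaussianReal 0 (‖z‖₊ ^ 2)|
      ≤ (r + 1) * t + 3 * 2 ^ ℓ / 2 ^ r := by
  choose a ha1 ha2 using fun k => exists_int_abs_le_abs_abs_sub_le_one (z.ofLp k * 2 ^ r)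
  have hr : (0 : ℝ) < 2 ^ r := by positivity
  set z' : EuclideanSpace ℝ (Fin (2 ^ ℓ)) := WithLp.toLp 2 (dyadicVector r a) with hz'
  have hu : ∀ k, |z.ofLp k - dyadicVector r a k| ≤ 1 / 2 ^ r := fun k => by
    have h := ha2 k
    have e : z.ofLp k * 2 ^ r - a k = (z.ofLp k - dyadicVector r a k) * 2 ^ r := by
      rw [sub_mul, dyadicVector, div_mul_cancel₀ _ hr.ne']
    rwa [e, abs_mul, abs_of_pos hr, ← le_div_iff₀ hr] at h
  have hzsq : ∑ k, z.ofLp k ^ 2 ≤ 1 := by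
    rw [← EuclideanSpace.real_norm_sq_eq]
    exact pow_le_one₀ (norm_nonneg _) hz
  have ha : ∑ k, a k ^ 2 ≤ 4 ^ r := by
    have h : ∑ k, (a k : ℝ) ^ 2 ≤ 4 ^ r := by
      calc ∑ k, (a k : ℝ) ^ 2 ≤ ∑ k, (z.ofLp k * 2 ^ r) ^ 2 :=
            Finset.sum_le_sum fun k _ => sq_le_sq.2 (ha1 k)
        _ = (∑ k, z.ofLp k ^ 2) * 4 ^ r := by
            rw [Finset.sum_mul]
            refine Finset.sum_congr rfl fun k _ => ?_
            rw [mul_pow, ← pow_mul, mul_comm r, pow_mul]; norm_num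
        _ ≤ 1 * 4 ^ r := by gcongr
        _ = 4 ^ r := one_mul _
    exact_mod_cast h
  have h1 := abs_rhtAverage_dyadicVector_sub_le hm hg ha
  have h2 : |rhtAverage g f z.ofLp - rhtAverage g f (dyadicVector r a)|
      ≤ 2 ^ ℓ * (1 / 2 ^ r) * 2 :=
    (abs_rhtAverage_sub_le g hf _ _).trans
      (rhtAverage_abs_le g (by positivity) hg2 (u := z.ofLp - dyadicVector r a) hu)
  have h3 : ‖z - z'‖ ≤ 2 ^ ℓ * (1 / 2 ^ r) := by
    refine abs_le_of_sq_le_sq' ?_ (by positivity) |>.2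
    rw [EuclideanSpace.real_norm_sq_eq]
    calc ∑ k, (z - z').ofLp k ^ 2 ≤ ∑ k : Fin (2 ^ ℓ), (1 / 2 ^ r : ℝ) ^ 2 := by
          refine Finset.sum_le_sum fun k _ => ?_
          rw [← sq_abs]
          exact pow_le_pow_left₀ (abs_nonneg _) (hu k) 2
      _ = 2 ^ ℓ * (1 / 2 ^ r) ^ 2 := by simp
      -- √d is weakened to d, so that all rounding errors are multiples of d/2^r.
      _ ≤ (2 ^ ℓ) ^ 2 * (1 / 2 ^ r) ^ 2 := by
          gcongr
          exact le_self_pow₀ (one_le_pow₀ (by norm_num)) (by norm_num)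
      _ = _ := by rw [mul_pow]
  have h4 : (∑ k, dyadicVector r a k ^ 2).toNNReal = ‖z'‖₊ ^ 2 := by
    ext
    rw [Real.coe_toNNReal _ (Finset.sum_nonneg fun _ _ => sq_nonneg _)]
    push_cast
    rw [EuclideanSpace.real_norm_sq_eq]
  have h5 : |gaussianSmooth f (‖z'‖₊ ^ 2) 0 - gaussianSmooth f (‖z‖₊ ^ 2) 0|
      ≤ 2 ^ ℓ * (1 / 2 ^ r) := by
    refine (abs_gaussianSmooth_sub_le hf _ _).trans ?_
    push_cast
    rw [Real.sqrt_sq (norm_nonneg _), Real.sqrt_sq (norm_nonneg _)]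
    refine (abs_norm_sub_norm_le _ _).trans ?_
    rwa [norm_sub_rev]
  rw [h4] at h1
  have h6 : ∫ x, f x ∂gaussianReal 0 (‖z‖₊ ^ 2) = gaussianSmooth f (‖z‖₊ ^ 2) 0 := by
    simp [gaussianSmooth]
  rw [h6]
  have h7 : 3 * 2 ^ ℓ / 2 ^ r = 2 ^ ℓ * (1 / 2 ^ r) * 2 + 2 ^ ℓ * (1 / 2 ^ r : ℝ) := by ring
  rw [h7]
  rw [abs_le] at *
  constructor <;> linarith [h1.1, h1.2, h2.1, h2.2, h5.1, h5.2]

theorem gaussianPi_exists_deviation_le (hm : 0 < m) {f : ℝ → ℝ} (hf : LipschitzWith 1 f)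
    {t : ℝ} (ht : 0 < t) (r : ℕ)
    (hX : 2 ^ ℓ * (2 * 2 ^ r + 1) * Real.exp (-(m * t ^ 2) / 128) ≤ 1) :
    gaussianPi (Fin m × Fin (2 ^ ℓ)) {g | ¬ ∀ z : EuclideanSpace ℝ (Fin (2 ^ ℓ)), ‖z‖ ≤ 1 →
      |rhtAverage g f z.ofLp - ∫ x, f x ∂gaussianReal 0 (‖z‖₊ ^ 2)|
        ≤ (r + 1) * t + 3 * 2 ^ ℓ / 2 ^ r}
    ≤ ENNReal.ofReal (2 ^ ℓ * (2 * Real.exp (-(m : ℝ) / 32)) + (r + 1) * ((4 ^ r + 1) *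
        (2 * (2 ^ ℓ * (2 * 2 ^ r + 1) * Real.exp (-(m * t ^ 2) / 128))))) := by
  rw [ENNReal.ofReal_add (by positivity) (by positivity)]
  have h1 : gaussianPi (Fin m × Fin (2 ^ ℓ))
      (⋃ k : Fin (2 ^ ℓ), {g | 2 ≤ rhtAverage g (fun s => |s|) (Pi.single k 1)})
      ≤ ENNReal.ofReal (2 ^ ℓ * (2 * Real.exp (-(m : ℝ) / 32))) := by
    refine (measure_iUnion_fintype_le _ _).trans ((Finset.sum_le_sum fun k _ =>
      gaussianPi_two_le_rhtAverage_abs_single_le hm k).trans (le_of_eq ?_))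
    rw [Finset.sum_const, Finset.card_univ, Fintype.card_fin, nsmul_eq_mul,
      ← ENNReal.ofReal_natCast, ← ENNReal.ofReal_mul (by positivity)]
    push_cast
    rfl
  refine (measure_mono ?_).trans ((measure_union_le _ _).trans
    (add_le_add h1 (gaussianPi_iUnion_scaleDeviation_le hm hf ht r hX)))
  intro g hg
  by_contra hcon
  simp only [Set.mem_union, Set.mem_iUnion, Finset.mem_range, not_or, not_exists] at hcon
  exact hg fun z hz => abs_rhtAverage_sub_integral_le hm hf
    (fun q hq p n hn => hcon.2 q (Nat.lt_succ_of_le hq) p n (Nat.lt_succ_of_le hn))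
    (fun k => (not_le.1 (hcon.1 k)).le) z hz

end UniformBound

/-! ### Choice of parameters -/

section Parameters

theorem exists_dyadic_scale {D : ℝ} (hD : 2 ≤ D) :
    ∃ r : ℕ, 8 * D ≤ 2 ^ r ∧ (2 : ℝ) ^ r ≤ 16 * D ∧ (r + 1 : ℝ) ≤ 9 * Real.log D := by
  obtain ⟨n, h1, h2⟩ := exists_nat_pow_near (show (1 : ℝ) ≤ 8 * D by linarith)
    (show (1 : ℝ) < 2 by norm_num)
  have h3 : (2 : ℝ) ^ (n + 1) ≤ 16 * D := by rw [pow_succ]; linarith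
  refine ⟨n + 1, h2.le, h3, ?_⟩
  -- Since D ≥ 2 absorbs constants, r + 1 ≤ 6 log D / log 2, and 6 / log 2 < 9.
  have h4 : (2 : ℝ) ^ (n + 1 + 1) ≤ D ^ 6 := by
    have : (2 : ℝ) ^ 5 ≤ D ^ 5 := pow_le_pow_left₀ (by norm_num) hD 5
    calc (2 : ℝ) ^ (n + 1 + 1) ≤ 2 ^ 5 * D := by rw [pow_succ]; linarith
      _ ≤ D ^ 5 * D := by gcongr
      _ = D ^ 6 := by ring
  have h5 := Real.log_le_log (by positivity) h4
  rw [Real.log_pow, Real.log_pow] at h5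
  push_cast at h5 ⊢
  have h6 := Real.log_two_gt_d9
  have h7 : (0 : ℝ) ≤ n := Nat.cast_nonneg n
  nlinarith

theorem deviation_exponents_le {m r : ℕ} {D Λ ε : ℝ} (hε0 : 0 < ε) (hε : ε < 1 / 2)
    (hD : 2 ≤ D) (hΛ : Real.log 2 ≤ Λ)
    (hm : 10000000 * (ε ^ 2)⁻¹ * Real.log D ^ 5 * Λ ≤ (m : ℝ))
    (hr : (r + 1 : ℝ) ≤ 9 * Real.log D) :
    32 * Real.log D + Λ + Real.log 2 ≤ m * (ε / (2 * (r + 1))) ^ 2 / 128 ∧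
      Real.log D + Λ + 2 * Real.log 2 ≤ m / 32 := by
  have hl2 := Real.log_two_gt_d9
  have hG0 : 0.69 ≤ Real.log D := by
    have := Real.log_le_log (by norm_num) hD
    linarith
  generalize Real.log D = G at *
  have hΛ0 : 0.69 ≤ Λ := by linarith
  have hG2 : 0.476 ≤ G ^ 2 := by nlinarith
  have hG3 : 0.328 ≤ G ^ 3 := by nlinarith
  have hGΛ : 0.328 * G ≤ G ^ 3 * Λ := by
    have h1 : 0.328 ≤ G ^ 2 * Λ := by nlinarith
    have h2 := mul_le_mul_of_nonneg_left h1 (show 0 ≤ G by linarith)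
    nlinarith
  have hΛG : 0.328 * Λ ≤ G ^ 3 * Λ := mul_le_mul_of_nonneg_right hG3 (by linarith)
  constructor
  · have hr0 : (0 : ℝ) < r + 1 := by positivity
    have h1 : (r + 1 : ℝ) ^ 2 ≤ (9 * G) ^ 2 := pow_le_pow_left₀ hr0.le hr 2
    have h2 : 10000000 * G ^ 5 * Λ ≤ m * ε ^ 2 := by
      have := mul_le_mul_of_nonneg_right hm (sq_nonneg ε)
      calc 10000000 * G ^ 5 * Λ = 10000000 * (ε ^ 2)⁻¹ * G ^ 5 * Λ * ε ^ 2 := by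
            field_simp
        _ ≤ _ := this
    have h3 : m * (ε / (2 * (r + 1))) ^ 2 / 128 = m * ε ^ 2 / (512 * (r + 1) ^ 2) := by
      field_simp; ring
    -- Two of the five logarithms cancel (r+1)² ≤ (9G)². The remaining G³Λ dominates both G and Λ
    -- because both are bounded below. The constant needed is 200 · 512 · 81 = 8294400.
    have h5 : 0 ≤ G ^ 5 * Λ := by positivity
    have h6 : 200 * (G ^ 3 * Λ) ≤ m * ε ^ 2 / (512 * (r + 1) ^ 2) := by
      rw [le_div_iff₀ (by positivity)]
      calc 200 * (G ^ 3 * Λ) * (512 * (r + 1) ^ 2)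
          ≤ 200 * (G ^ 3 * Λ) * (512 * (9 * G) ^ 2) := by gcongr
        _ = 8294400 * (G ^ 5 * Λ) := by ring
        _ ≤ 10000000 * G ^ 5 * Λ := by linarith
        _ ≤ _ := h2
    rw [h3]
    linarith
  · have h5 : 0 ≤ G ^ 5 * Λ := by positivity
    have h1 : 10000000 * (G ^ 5 * Λ) ≤ m := by
      refine le_trans ?_ hm
      have h2 : 1 ≤ (ε ^ 2)⁻¹ := (one_le_inv₀ (by positivity)).2 (by nlinarith)
      have := mul_le_mul_of_nonneg_right h2 h5
      linarith
    have h2 : 0.476 * (G ^ 3 * Λ) ≤ G ^ 5 * Λ := by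
      have := mul_le_mul_of_nonneg_right hG2 (show 0 ≤ G ^ 3 * Λ by positivity)
      linarith
    linarith

theorem union_bound_prefactor_le (ℓ r : ℕ) {e : ℝ} (he : 0 ≤ e) :
    ((r : ℝ) + 1) * ((4 ^ r + 1) * (2 * (2 ^ ℓ * (2 * 2 ^ r + 1) * e)))
      ≤ (4 * 2 ^ ℓ * 2 ^ r) ^ 4 * e := by
  have hd1 : (1 : ℝ) ≤ 2 ^ ℓ := one_le_pow₀ (by norm_num)
  have h2r : (1 : ℝ) ≤ 2 ^ r := one_le_pow₀ (by norm_num)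
  have hr1 : (r : ℝ) + 1 ≤ 2 ^ r := by exact_mod_cast Nat.lt_two_pow_self
  have h4 : (4 : ℝ) ^ r = 2 ^ r * 2 ^ r := by rw [← mul_pow]; norm_num
  have h41 : (4 : ℝ) ^ r + 1 ≤ 2 * (2 ^ r * 2 ^ r) := by
    rw [h4]; linarith [one_le_mul_of_one_le_of_one_le h2r h2r]
  calc ((r : ℝ) + 1) * ((4 ^ r + 1) * (2 * (2 ^ ℓ * (2 * 2 ^ r + 1) * e)))
      ≤ 2 ^ r * ((2 * (2 ^ r * 2 ^ r)) * (2 * (2 ^ ℓ * (4 * 2 ^ r) * e))) := by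
        gcongr; linarith
    _ = (16 * (2 ^ r) ^ 4 * e) * (2 ^ ℓ) ^ 1 := by ring
    _ ≤ (256 * (2 ^ r) ^ 4 * e) * (2 ^ ℓ) ^ 4 := by
        gcongr <;> norm_num
    _ = _ := by ring

theorem failure_probability_le {ℓ m r : ℕ} {δ ε : ℝ} (hδ0 : 0 < δ) (hδ : δ < 1 / 2)
    (hε0 : 0 < ε) (hε : ε < 1 / 2)
    (hm : 10000000 * (ε ^ 2)⁻¹ * Real.log ((2 : ℝ) ^ ℓ / ε) ^ 5 * Real.log (1 / δ) ≤ (m : ℝ))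
    (hr : (2 : ℝ) ^ r ≤ 16 * ((2 : ℝ) ^ ℓ / ε))
    (hr2 : (r + 1 : ℝ) ≤ 9 * Real.log ((2 : ℝ) ^ ℓ / ε)) :
    2 ^ ℓ * (2 * 2 ^ r + 1) * Real.exp (-(m * (ε / (2 * (r + 1))) ^ 2) / 128) ≤ 1 ∧
    2 ^ ℓ * (2 * Real.exp (-(m : ℝ) / 32)) + (r + 1) * ((4 ^ r + 1) *
        (2 * (2 ^ ℓ * (2 * 2 ^ r + 1) * Real.exp (-(m * (ε / (2 * (r + 1))) ^ 2) / 128)))) ≤ δ := by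
  have hd1 : (1 : ℝ) ≤ 2 ^ ℓ := one_le_pow₀ (by norm_num)
  have hD2 : 2 ≤ (2 : ℝ) ^ ℓ / ε := by rw [le_div_iff₀ hε0]; linarith
  have hdD : (2 : ℝ) ^ ℓ ≤ (2 : ℝ) ^ ℓ / ε := le_div_self (by linarith) hε0 (by linarith)
  have hΛ2 : Real.log 2 ≤ Real.log (1 / δ) := by
    refine Real.log_le_log (by norm_num) ?_
    rw [le_div_iff₀ hδ0]; linarith
  have hexpG : Real.exp (Real.log ((2 : ℝ) ^ ℓ / ε)) = (2 : ℝ) ^ ℓ / ε := Real.exp_log (by linarith)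
  have hexpΛ : Real.exp (-Real.log (1 / δ)) = δ := by
    rw [one_div, Real.log_inv, neg_neg, Real.exp_log hδ0]
  have hexp2 : Real.exp (-Real.log 2) = 1 / 2 := by
    rw [Real.exp_neg, Real.exp_log (by norm_num), one_div]
  obtain ⟨hy, hmm⟩ := deviation_exponents_le hε0 hε hD2 hΛ2 hm hr2
  clear hm hr2
  generalize Real.log (1 / δ) = Λ at *
  generalize (2 : ℝ) ^ ℓ / ε = D at *
  rw [neg_div]
  generalize m * (ε / (2 * (r + 1))) ^ 2 / 128 = y at *
  -- The fourth power of this, D^32, is the origin of the term 32 log D in the exponent.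
  have hMD : 4 * 2 ^ ℓ * 2 ^ r ≤ D ^ 8 := by
    have h6 : (2 : ℝ) ^ 6 ≤ D ^ 6 := pow_le_pow_left₀ (by norm_num) hD2 6
    calc 4 * (2 : ℝ) ^ ℓ * 2 ^ r ≤ 4 * D * (16 * D) := by gcongr
      _ = 2 ^ 6 * D ^ 2 := by ring
      _ ≤ D ^ 6 * D ^ 2 := by gcongr
      _ = D ^ 8 := by ring
  have hkey : (4 * 2 ^ ℓ * 2 ^ r) ^ 4 * Real.exp (-y) ≤ δ / 2 := by
    calc (4 * 2 ^ ℓ * 2 ^ r) ^ 4 * Real.exp (-y)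
        ≤ (D ^ 8) ^ 4 * Real.exp (-(32 * Real.log D + Λ + Real.log 2)) := by gcongr
      _ = Real.exp (32 * Real.log D) * Real.exp (-(32 * Real.log D + Λ + Real.log 2)) := by
          rw [show (32 : ℝ) * Real.log D = ((32 : ℕ) : ℝ) * Real.log D by norm_num,
            Real.exp_nat_mul, hexpG, ← pow_mul]
      _ = Real.exp (-Λ) * Real.exp (-Real.log 2) := by
          rw [← Real.exp_add, ← Real.exp_add]; congr 1; ring
      _ = δ / 2 := by rw [hexpΛ, hexp2]; ring
  have h2 := union_bound_prefactor_le ℓ r (Real.exp_pos (-y)).le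
  have h1 : (2 : ℝ) ^ ℓ * (2 * Real.exp (-(m : ℝ) / 32)) ≤ δ / 2 := by
    calc (2 : ℝ) ^ ℓ * (2 * Real.exp (-(m : ℝ) / 32))
        ≤ D * (2 * Real.exp (-(Real.log D + Λ + 2 * Real.log 2))) := by
          gcongr
          rw [neg_div]; linarith
      _ = 2 * (Real.exp (Real.log D) * Real.exp (-(Real.log D + Λ + 2 * Real.log 2))) := by
          rw [hexpG]; ring
      _ = 2 * (Real.exp (-Λ) * (Real.exp (-Real.log 2) * Real.exp (-Real.log 2))) := by
          rw [← Real.exp_add, ← Real.exp_add, ← Real.exp_add]; congr 2; ring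
      _ = δ / 2 := by rw [hexpΛ, hexp2]; ring
  refine ⟨?_, by linarith⟩
  -- X is dominated by the union bound containing it, hence by δ/2 < 1.
  set X := (2 : ℝ) ^ ℓ * (2 * 2 ^ r + 1) * Real.exp (-y) with hX
  have hX0 : 0 ≤ X := by positivity
  have h3 : X ≤ ((r : ℝ) + 1) * ((4 ^ r + 1) * (2 * X)) := by
    have h4 : (0 : ℝ) ≤ 4 ^ r := by positivity
    have h5 : X ≤ (4 ^ r + 1) * (2 * X) := by
      have := mul_nonneg h4 hX0
      linarith
    exact h5.trans (le_mul_of_one_le_left (by positivity) (by linarith [Nat.cast_nonneg (α := ℝ) r]))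
  linarith

end Parameters

/-! ### Transfer to an arbitrary probability space -/

theorem stackedRHT_eq_rhtForm {ℓ m : ℕ} (g : Fin m → Fin (2 ^ ℓ) → ℝ)
    (z : EuclideanSpace ℝ (Fin (2 ^ ℓ))) (j : Fin m) (k : Fin (2 ^ ℓ)) :
    stackedRHT g z j k = rhtForm z.ofLp (j, k) (fun p => g p.1 p.2) := by
  rw [stackedRHT, rhtForm_apply, Matrix.mulVec, dotProduct]
  refine Finset.sum_congr rfl fun k' _ => ?_
  rw [Matrix.mul_diagonal]; ring

theorem theorem1 :
    ∃ C : ℝ, 0 < C ∧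
      ∀ (ℓ m : ℕ) (δ ε : ℝ) (f : ℝ → ℝ),
        0 < δ → δ < 1 / 2 → 0 < ε → ε < 1 / 2 → LipschitzWith 1 f →
        C * (ε ^ 2)⁻¹ * Real.log ((2 : ℝ) ^ ℓ / ε) ^ 5 * Real.log (1 / δ) ≤ (m : ℝ) →
        ∀ (Ω : Type*) [MeasurableSpace Ω] (P : Measure Ω) [IsProbabilityMeasure P]
          (g : Fin m → Fin (2 ^ ℓ) → Ω → ℝ),
          (∀ j k, HasLaw (g j k) (gaussianReal 0 1) P) →
          iIndepFun (fun (p : Fin m × Fin (2 ^ ℓ)) => g p.1 p.2) P →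
          ENNReal.ofReal (1 - δ) ≤
            P {ω | ∀ z : EuclideanSpace ℝ (Fin (2 ^ ℓ)), ‖z‖ ≤ 1 →
              |1 / ((m : ℝ) * (2 : ℝ) ^ ℓ) *
                  (∑ j : Fin m, ∑ k : Fin (2 ^ ℓ), f (stackedRHT (fun j' k' => g j' k' ω) z j k))
                - ∫ x, f x ∂(gaussianReal 0 (‖z‖₊ ^ 2))| ≤ ε} := by
  refine ⟨10000000, by norm_num, ?_⟩
  intro ℓ m δ ε f hδ0 hδ hε0 hε hf hm Ω _ P _ g hlaw hind
  have hd1 : (1 : ℝ) ≤ 2 ^ ℓ := one_le_pow₀ (by norm_num)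
  have hD2 : 2 ≤ (2 : ℝ) ^ ℓ / ε := by rw [le_div_iff₀ hε0]; linarith
  have hm0 : 0 < m := by
    have h1 : 0 < Real.log ((2 : ℝ) ^ ℓ / ε) := Real.log_pos (by linarith)
    have h2 : 0 < Real.log (1 / δ) := Real.log_pos (by rw [lt_div_iff₀ hδ0]; linarith)
    have : (0 : ℝ) < m := lt_of_lt_of_le (by positivity) hm
    exact_mod_cast this
  obtain ⟨r, hr1, hr2, hr3⟩ := exists_dyadic_scale hD2
  obtain ⟨hX, hfail⟩ := failure_probability_le hδ0 hδ hε0 hε hm hr2 hr3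
  have hdev := gaussianPi_exists_deviation_le (ℓ := ℓ) hm0 hf
    (t := ε / (2 * (r + 1))) (by positivity) r hX
  have hbound : (r + 1) * (ε / (2 * (r + 1))) + 3 * 2 ^ ℓ / 2 ^ r ≤ ε := by
    have h1 : ((r : ℝ) + 1) * (ε / (2 * (r + 1))) = ε / 2 := by field_simp
    have h2 : 3 * (2 : ℝ) ^ ℓ / 2 ^ r ≤ ε / 2 := by
      rw [div_le_iff₀ (by positivity)]
      rw [← mul_div_assoc, div_le_iff₀ hε0] at hr1
      nlinarith
    linarith
  set X : Ω → Fin m × Fin (2 ^ ℓ) → ℝ := fun ω p => g p.1 p.2 ω with hXdef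
  have hXm : AEMeasurable X P := aemeasurable_pi_lambda _ fun p => (hlaw p.1 p.2).aemeasurable
  have hmap : P.map X = gaussianPi (Fin m × Fin (2 ^ ℓ)) := by
    rw [hXdef, (iIndepFun_iff_map_fun_eq_pi_map (f := fun (p : Fin m × Fin (2 ^ ℓ)) => g p.1 p.2)
      fun p => (hlaw p.1 p.2).aemeasurable).1 hind]
    congr 1
    ext1 p
    exact (hlaw p.1 p.2).map_eq
  set S := {ω | ∀ z : EuclideanSpace ℝ (Fin (2 ^ ℓ)), ‖z‖ ≤ 1 →
    |1 / ((m : ℝ) * (2 : ℝ) ^ ℓ) *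
      (∑ j : Fin m, ∑ k : Fin (2 ^ ℓ), f (stackedRHT (fun j' k' => g j' k' ω) z j k))
      - ∫ x, f x ∂(gaussianReal 0 (‖z‖₊ ^ 2))| ≤ ε} with hS
  have hSc : P Sᶜ ≤ ENNReal.ofReal δ := by
    refine le_trans ?_ (hdev.trans (ENNReal.ofReal_le_ofReal hfail))
    rw [← hmap]
    -- The event quantifies over uncountably many z. This inequality holds for arbitrary sets, and
    -- the closing complement step uses only subadditivity, so measurability is never needed.
    refine (measure_mono ?_).trans (Measure.le_map_apply hXm _)
    intro ω hω hcon
    refine hω fun z hz => ?_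
    refine le_trans (le_of_eq ?_) ((hcon z hz).trans hbound)
    simp only [stackedRHT_eq_rhtForm, rhtAverage, Fintype.sum_prod_type, hXdef]
  rw [ENNReal.ofReal_sub _ hδ0.le, ENNReal.ofReal_one, tsub_le_iff_right, ← measure_univ (μ := P),
    ← Set.union_compl_self S]
  exact (measure_union_le _ _).trans (add_le_add le_rfl hSc)
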